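/- Let $d\ge 0$. All simplicial complexes are finite and contain the empty face. For a $(d-1)$-dimensional simplicial complex $\Delta$ let $f_{i-1}^\Delta$ be the number of its faces with $i$ vertices, and let the $h$-vector $h^\Delta=(h_0^\Delta,\dots,h_d^\Delta)$ be defined by $\sum_{i=0}^d h_i^\Delta x^{d-i}=\sum_{i=0}^d f_{i-1}^\Delta (x-1)^{d-i}$. Consider the conditions (1) $h_0^\Delta,\dots,h_d^\Delta>0$ and $\dfrac{h_0^\Delta}{h_d^\Delta}\le\dfrac{h_1^\Delta}{h_{d-1}^\Delta}\le\cdots\le\dfrac{h_{d-1}^\Delta}{h_1^\Delta}\le\dfrac{h_d^\Delta}{h_0^\Delta}$; (2) $h_1^\Delta,\dots,h_{d-1}^\Delta>0$, $h_d^\Delta=0$ and $\dfrac{h_1^\Delta}{h_{d-1}^\Delta}\ge\dfrac{h_2^\Delta}{h_{d-2}^\Delta}\ge\cdots\ge\dfrac{h_{d-1}^\Delta}{h_1^\Delta}$. Let $\mathcal F=(f_{ij})_{0\le i\le j\le d-1}$ be a triangular array of non-negative integers. A simplicial complex $\Delta'$ is a face uniform subdivision of $\Delta$ with array $\mathcal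 F$, written $\Delta'=\Delta_{\mathcal F}$, if there are geometric realizations (by geometric simplices in a common real vector space) with $|\Delta|=|\Delta'|$ such that for every face $\sigma\in\Delta$ the simplex $|\sigma|$ is a union of simplices $|\tau|$, $\tau\in\Delta'$, and such that for all $0\le i\le j\le d-1$ and every $j$-dimensional face $\sigma\in\Delta$ there are exactly $f_{ij}$ faces $\tau\in\Delta'$ of dimension $i$ with $|\tau|\subseteq|\sigma|$. Let $H_{\mathcal F}=(h_{ij})_{0\le i,j\le d}$ be the matrix with $h^{\Delta_{\mathcal F}}=H_{\mathcal F}\,h^\Delta$ for $(d-1)$-dimensional complexes $\Delta$. Explicitly, $H_{\mathcal F}=A\,B\,A^{-1}$, where $A=\big((-1)^{i+j}\binom{d-j}{d-i}\big)_{0\le i,j\le d}$ transforms $f$-vectors into $h$-vectors, and $B=(b_{ij})_{0\le i,j\le d}$ with $b_{ij}=\sum_{k=0}^{j}(-1)^{j-k}\binom jk f_{i-1,k-1}$ (where $f_{-1,k-1}=1$, and $f_{i-1,k-1}=0$ if $i>k$) counts the faces with $i$ vertices in the subdivision of a simplex with $j$ vertices that lie in no proper face of this simplex. A real matrix is TP$_2$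 if all its entries and all its $2\times2$ minors are non-negative. **Proposition.** If $H_{\mathcal F}$ is TP$_2$, then for every $(d-1)$-dimensional simplicial complex $\Delta$ and every face uniform subdivision $\Delta_{\mathcal F}$ of $\Delta$ with array $\mathcal F$: (i) if $\Delta$ satisfies (1), then $\Delta_{\mathcal F}$ satisfies (1); (ii) if $\Delta$ satisfies (2), then $\Delta_{\mathcal F}$ satisfies (2). -/

import Mathlib

open Polynomial

noncomputable section

namespace FaceUniform

/-! ### Simplicial complexes, `f`-vectors and `h`-vectors

A simplicial complex over a finite ground set `V` is given by its nonempty faces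
(`PreAbstractSimplicialComplex V`); the empty face is put back by `allFaces`. -/

/-- All faces of `Δ`, including the empty one. -/
def allFaces {V : Type*} (Δ : PreAbstractSimplicialComplex V) : Set (Finset V) :=
  insert ∅ Δ.faces

/-- `rank Δ = dim Δ + 1`, the largest number of vertices of a face. -/
def rank {V : Type*} (Δ : PreAbstractSimplicialComplex V) : ℕ :=
  sSup (Finset.card '' allFaces Δ)

/-- `fNumber Δ i` is the number `f_{i-1}` of faces with `i` vertices, i.e. of dimension `i - 1`. -/
def fNumber {V : Type*} (Δ : PreAbstractSimplicialComplex V) (i : ℕ) : ℕ :=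
  {σ ∈ allFaces Δ | σ.card = i}.ncard

/-- `f(x) = ∑_{i=0}^d f_{i-1} x^{d-i}`, where `dim Δ = d - 1`. -/
def fPolynomial {V : Type*} (Δ : PreAbstractSimplicialComplex V) : ℝ[X] :=
  ∑ i ∈ Finset.range (rank Δ + 1), C (fNumber Δ i : ℝ) * X ^ (rank Δ - i)

/-- `h(x) = f(x - 1)`. -/
def hPolynomial {V : Type*} (Δ : PreAbstractSimplicialComplex V) : ℝ[X] :=
  (fPolynomial Δ).comp (X - 1)

/-- The entry `h_i` (`0 ≤ i ≤ d`) of the `h`-vector: `h(x) = ∑_{i=0}^d h_i x^{d-i}`. -/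
def hNumber {V : Type*} (Δ : PreAbstractSimplicialComplex V) (i : ℕ) : ℝ :=
  (hPolynomial Δ).coeff (rank Δ - i)

/-- `h_0, …, h_d > 0` and `h_0 / h_d ≤ h_1 / h_{d-1} ≤ ⋯ ≤ h_d / h_0`, where `dim Δ = d - 1`. -/
def IncreasingRatios {V : Type*} (Δ : PreAbstractSimplicialComplex V) : Prop :=
  (∀ i, i ≤ rank Δ → 0 < hNumber Δ i) ∧
  ∀ i, i < rank Δ →
    hNumber Δ i / hNumber Δ (rank Δ - i) ≤ hNumber Δ (i + 1) / hNumber Δ (rank Δ - (i + 1))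

/-- `h_1, …, h_{d-1} > 0`, `h_d = 0` and `h_1 / h_{d-1} ≥ h_2 / h_{d-2} ≥ ⋯ ≥ h_{d-1} / h_1`,
where `dim Δ = d - 1`. -/
def DecreasingRatios {V : Type*} (Δ : PreAbstractSimplicialComplex V) : Prop :=
  (∀ i, 1 ≤ i → i < rank Δ → 0 < hNumber Δ i) ∧
  hNumber Δ (rank Δ) = 0 ∧
  ∀ i, 1 ≤ i → i + 1 < rank Δ →
    hNumber Δ i / hNumber Δ (rank Δ - i) ≥ hNumber Δ (i + 1) / hNumber Δ (rank Δ - (i + 1))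

/-! ### Geometric realizations and face uniform subdivisions -/

/-- The simplex `|σ|` spanned by the images of the vertices of `σ` under `x`. -/
def simplex {V E : Type*} [AddCommGroup E] [Module ℝ E] (x : V → E) (σ : Finset V) : Set E :=
  convexHull ℝ (x '' (σ : Set V))

/-- The vertex placement `x` defines a geometric realization of `Δ`: each face `σ` spans a simplex
of dimension `#σ - 1`, and `|σ| ∩ |τ| = |σ ∩ τ|` for all faces `σ`, `τ`. -/
structure IsRealization {V E : Type*} [AddCommGroup E] [Module ℝ E]
    (Δ : PreAbstractSimplicialComplex V) (x : V → E) : Prop where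
  indep : ∀ σ ∈ allFaces Δ, AffineIndependent ℝ (fun v : σ => x v)
  inter : ∀ σ ∈ allFaces Δ, ∀ τ ∈ allFaces Δ,
    simplex x σ ∩ simplex x τ = convexHull ℝ (x '' ((σ : Set V) ∩ (τ : Set V)))

/-- The underlying space of the realization of `Δ` by `x`. -/
def space {V E : Type*} [AddCommGroup E] [Module ℝ E]
    (Δ : PreAbstractSimplicialComplex V) (x : V → E) : Set E :=
  ⋃ σ ∈ allFaces Δ, simplex x σ

/-- `Δ'` is a face uniform subdivision of `Δ` (inside the real vector space `E`) with triangular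
array `F = (F i j)_{0 ≤ i ≤ j}`: there are geometric realizations with `|Δ| = |Δ'|` such that each
simplex `|σ|`, `σ ∈ Δ`, is a union of simplices of `Δ'`, and for each face `σ` of `Δ` of dimension
`j` the number of `i`-dimensional faces `τ` of `Δ'` with `|τ| ⊆ |σ|` is `F i j`. Only the entries
`F i j` with `i ≤ j` are used. -/
def IsFaceUniformSubdivision {V W : Type*} (E : Type*) [AddCommGroup E] [Module ℝ E]
    (F : ℕ → ℕ → ℕ) (Δ : PreAbstractSimplicialComplex V)
    (Δ' : PreAbstractSimplicialComplex W) : Prop :=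
  ∃ (x : V → E) (y : W → E), IsRealization Δ x ∧ IsRealization Δ' y ∧
    space Δ x = space Δ' y ∧
    (∀ σ ∈ allFaces Δ, ∃ S ⊆ allFaces Δ', simplex x σ = ⋃ τ ∈ S, simplex y τ) ∧
    ∀ i j, i ≤ j → ∀ σ ∈ allFaces Δ, σ.card = j + 1 →
      {τ ∈ allFaces Δ' | simplex y τ ⊆ simplex x σ ∧ τ.card = i + 1}.ncard = F i j

/-! ### The transformation matrix of `h`-vectors and total positivity -/

/-- The number of faces with `i` vertices in the subdivision, with array `F`, of a simplex with
`k` vertices; the empty face is counted for `i = 0`. -/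
def simplexCount (F : ℕ → ℕ → ℕ) (i k : ℕ) : ℕ :=
  if i = 0 then 1 else if i ≤ k then F (i - 1) (k - 1) else 0

/-- The number of faces with `i` vertices in the subdivision of a simplex with `j` vertices that
lie in no proper face of the simplex, by inclusion-exclusion over the faces of the simplex. -/
def interiorCount (F : ℕ → ℕ → ℕ) (i j : ℕ) : ℝ :=
  ∑ k ∈ Finset.range (j + 1), (-1) ^ (j - k) * (j.choose k : ℝ) * (simplexCount F i k : ℝ)

/-- The transformation of `f`-vectors `(f_{-1}, …, f_{d-1})` under the subdivision: each face `τ`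
of the subdivided complex is an interior face for exactly one face of the complex. -/
def fMatrix (d : ℕ) (F : ℕ → ℕ → ℕ) : Matrix (Fin (d + 1)) (Fin (d + 1)) ℝ :=
  Matrix.of fun i j => interiorCount F i j

/-- The matrix which maps the `f`-vector to the `h`-vector, from `h(x) = f(x - 1)`.
(The binomial coefficient is `0` for `i < j`.) -/
def fToH (d : ℕ) : Matrix (Fin (d + 1)) (Fin (d + 1)) ℝ :=
  Matrix.of fun i j => (-1) ^ ((i : ℕ) + (j : ℕ)) * ((d - (j : ℕ)).choose (d - (i : ℕ)) : ℝ)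

/-- The matrix which maps the `h`-vector to the `f`-vector, from `f(x) = h(x + 1)`.
It is the inverse of `fToH d`. -/
def hToF (d : ℕ) : Matrix (Fin (d + 1)) (Fin (d + 1)) ℝ :=
  Matrix.of fun i j => ((d - (j : ℕ)).choose (d - (i : ℕ)) : ℝ)

/-- The matrix `H_F = (h_{ij})_{0 ≤ i, j ≤ d}` with `h(Δ_F) = H_F · h(Δ)` for the complexes `Δ` of
dimension `d - 1`: the transformation of `f`-vectors, written in terms of `h`-vectors. -/
def hMatrix (d : ℕ) (F : ℕ → ℕ → ℕ) : Matrix (Fin (d + 1)) (Fin (d + 1)) ℝ :=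
  fToH d * fMatrix d F * hToF d

/-- A real matrix is TP`_r` if all its `k × k` minors, `k = 1, …, r`, are non-negative. -/
def IsTP (r : ℕ) {m n : ℕ} (A : Matrix (Fin m) (Fin n) ℝ) : Prop :=
  ∀ k, 1 ≤ k → k ≤ r → ∀ (a : Fin k → Fin m) (b : Fin k → Fin n), StrictMono a → StrictMono b →
    0 ≤ (A.submatrix a b).det

end FaceUniform

end

/-! For positive entries, condition (1) says that the two-row matrix with rows `(h_d, …, h_0)` and
`(h_0, …, h_d)` has non-negative 2×2 minors; condition (2) gives the same with the rows exchanged,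
the minors that use an end column being harmless because `h_d = 0`. The matrix `H_F` maps the
h-vector of `Δ` to that of the subdivision. If it also maps the reversed vector to the reversed
vector, both rows are multiplied by `H_F`, and Cauchy–Binet (`dotProduct_mul_dotProduct_le`) shows
that a TP₂ matrix keeps the minors non-negative. Strict positivity holds because `H_F` is
non-negative and invertible, so no row vanishes; in case (2) the last row is `(0, …, 0, 1)`, so
every other row is non-zero outside the last column.

The main work is the symmetry `hMatrix_mulVec_rev`. In terms of f-vectors it is a reciprocity: in
the subdivision of a simplex `σ`, the signed counts of interior faces determine the counts of all
faces (`sum_isInterior_choose`). This follows from an Euler relation for stars (`sum_isInterior`):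
the sum of `(-1)^|ρ|` over interior faces `ρ` containing `τ` is `(-1)^|σ|`.

The Euler relation is obtained by linear algebra. Barycentric coordinates turn the subdivision of
`σ` into a simplicial fan filling the orthant of `ℝ^σ` (`exists_barycentric`). A generic positive
direction assigns each interior cone to one maximal cone, and the cones assigned to a given maximal
cone form a Boolean interval, whose alternating sum is trivial. -/

namespace FaceUniform

open Filter Topology

/-! ### Simplicial subdivisions of an orthant -/

/-- The simplicial fan with combinatorics `Γ` and rays `y` subdivides the non-negative orthant
of `ι → ℝ`. -/
structure SubdividesOrthant {ι W : Type*} [Fintype W]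
    (Γ : Finset (Finset W)) (y : W → ι → ℝ) : Prop where
  down : ∀ G ∈ Γ, ∀ ρ ⊆ G, ρ ∈ Γ
  nonneg : ∀ G ∈ Γ, ∀ v ∈ G, 0 ≤ y v
  inj : ∀ G ∈ Γ, ∀ G' ∈ Γ, ∀ c c' : W → ℝ, 0 ≤ c → 0 ≤ c' → (∀ v ∉ G, c v = 0) →
    (∀ v ∉ G', c' v = 0) →
    Fintype.linearCombination ℝ y c = Fintype.linearCombination ℝ y c' → c = c'
  cover : ∀ z : ι → ℝ, 0 ≤ z → ∃ G ∈ Γ, ∃ c : W → ℝ, 0 ≤ c ∧ (∀ v ∉ G, c v = 0) ∧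
    Fintype.linearCombination ℝ y c = z

namespace SubdividesOrthant

variable {ι W : Type*} {Γ : Finset (Finset W)} {y : W → ι → ℝ}

/-- A vector in the span of no cone of smaller dimension. -/
def IsGeneric [Fintype ι] (Γ : Finset (Finset W)) (y : W → ι → ℝ) (w : ι → ℝ) : Prop :=
  ∀ G ∈ Γ, G.card < Fintype.card ι → w ∉ Submodule.span ℝ (y '' (G : Set W))

theorem IsGeneric.neg [Fintype ι] {w : ι → ℝ} (hw : IsGeneric Γ y w) : IsGeneric Γ y (-w) := by
  intro G hG hc hm
  exact hw G hG hc (by simpa using Submodule.neg_mem _ hm)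

variable [Fintype W]

/-- The positive and negative parts of `c - c'` are non-negative, supported on `G` and have the same
image, so `inj` makes them equal and the difference vanishes. Thus uniqueness for non-negative
coefficients gives linear independence on each cone. -/
theorem eq_of_linearCombination_eq (h : SubdividesOrthant Γ y) {G : Finset W} (hG : G ∈ Γ)
    {c c' : W → ℝ} (hc : ∀ v ∉ G, c v = 0) (hc' : ∀ v ∉ G, c' v = 0)
    (e : Fintype.linearCombination ℝ y c = Fintype.linearCombination ℝ y c') : c = c' := by
  have key : (c - c')⁺ = (c - c')⁻ := by
    refine h.inj G hG G hG _ _ (posPart_nonneg _) (negPart_nonneg _) ?_ ?_ ?_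
    · intro v hv; simp [hc v hv, hc' v hv]
    · intro v hv; simp [hc v hv, hc' v hv]
    · rw [← sub_eq_zero, ← map_sub, posPart_sub_negPart, map_sub, e, sub_self]
  have := posPart_sub_negPart (c - c')
  rw [key, sub_self] at this
  exact (sub_eq_zero.mp this.symm)

theorem linearIndependent (h : SubdividesOrthant Γ y) {G : Finset W} (hG : G ∈ Γ) :
    LinearIndependent ℝ (fun v : G => y v) := by
  classical
  rw [Fintype.linearIndependent_iff]
  intro g hg v
  have := h.eq_of_linearCombination_eq hG
    (c := fun w => if hw : w ∈ G then g ⟨w, hw⟩ else 0) (c' := 0)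
    (by intro v hv; simp [hv]) (by simp) (by
      rw [map_zero, ← hg, Fintype.linearCombination_apply,
        ← Finset.sum_subset (Finset.subset_univ G) (by intro v _ hv; simp [hv]),
        ← Finset.sum_coe_sort]
      simp)
  simpa using congrFun this v

theorem finrank_span (h : SubdividesOrthant Γ y) {G : Finset W} (hG : G ∈ Γ) :
    Module.finrank ℝ (Submodule.span ℝ (y '' (G : Set W))) = G.card := by
  have := finrank_span_eq_card (h.linearIndependent hG)
  rw [Fintype.card_coe] at this
  rw [← this, Set.image_eq_range]
  rfl

theorem mem_span {G : Finset W} {c : W → ℝ} (hc : ∀ v ∉ G, c v = 0) :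
    Fintype.linearCombination ℝ y c ∈ Submodule.span ℝ (y '' (G : Set W)) := by
  rw [Fintype.linearCombination_apply]
  refine Submodule.sum_mem _ fun v _ => ?_
  by_cases hv : v ∈ G
  · exact Submodule.smul_mem _ _ (Submodule.subset_span ⟨v, hv, rfl⟩)
  · simp [hc v hv]

variable [Fintype ι]

theorem card_le (h : SubdividesOrthant Γ y) {G : Finset W} (hG : G ∈ Γ) :
    G.card ≤ Fintype.card ι := by
  simpa using (h.linearIndependent hG).fintype_card_le_finrank

/-- Coordinates with respect to a full-dimensional cone. -/
theorem exists_coord (h : SubdividesOrthant Γ y) {G : Finset W} (hG : G ∈ Γ)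
    (hc : G.card = Fintype.card ι) (w : ι → ℝ) :
    ∃ b : W → ℝ, (∀ v ∉ G, b v = 0) ∧ Fintype.linearCombination ℝ y b = w := by
  classical
  have htop : Submodule.span ℝ (y '' (G : Set W)) = ⊤ := by
    apply Submodule.eq_top_of_finrank_eq
    rw [h.finrank_span hG, hc]; simp
  have hw : w ∈ Submodule.span ℝ (y '' (G : Set W)) := htop ▸ Submodule.mem_top
  obtain ⟨c, hc⟩ := Submodule.mem_span_image_finset_iff_exists_fun' ℝ |>.mp hw
  refine ⟨fun v => if v ∈ G then c v else 0, by intro v hv; simp [hv], ?_⟩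
  rw [Fintype.linearCombination_apply, ← hc,
    ← Finset.sum_subset (Finset.subset_univ G) (by intro v _ hv; simp [hv])]
  exact Finset.sum_congr rfl fun v hv => by simp [hv]

theorem exists_isGeneric_pos (h : SubdividesOrthant Γ y) :
    ∃ q : ι → ℝ, IsGeneric Γ y q ∧ ∀ i, 0 < q i := by
  classical
  obtain ⟨r, hr⟩ : ∃ r : ι → ℝ, IsGeneric Γ y r := by
    let s : Finset (Submodule ℝ (ι → ℝ)) :=
      (Γ.filter fun G => G.card < Fintype.card ι).image
        fun G : Finset W => Submodule.span ℝ (y '' (G : Set W))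
    have hs : ⊤ ∉ s := by
      intro ht
      obtain ⟨G, hG, e⟩ := Finset.mem_image.mp ht
      rw [Finset.mem_filter] at hG
      have := h.finrank_span hG.1
      rw [e, finrank_top, Module.finrank_fintype_fun_eq_card] at this
      omega
    -- A real vector space is not a finite union of proper subspaces.
    have := Subspace.biUnion_ne_univ_of_top_notMem hs
    obtain ⟨r, hr⟩ := (Set.ne_univ_iff_exists_notMem _).mp this
    refine ⟨r, fun G hG hc hm => hr ?_⟩
    simp only [Set.mem_iUnion]
    exact ⟨_, Finset.mem_image_of_mem _ (Finset.mem_filter.mpr ⟨hG, hc⟩), hm⟩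
  have hpos : ∀ᶠ t in 𝓝[>] (0 : ℝ), ∀ i, 0 < 1 + t * r i := by
    rw [eventually_all]
    intro i
    have : Tendsto (fun t : ℝ => 1 + t * r i) (𝓝[>] 0) (𝓝 (1 + 0 * r i)) :=
      (Continuous.tendsto (by fun_prop) 0).mono_left nhdsWithin_le_nhds
    exact this.eventually_const_lt (by simp)
  -- Otherwise a single small span would contain these points for two values of `t`, hence also `r`,
  -- which is a multiple of their difference.
  have hgen : ∀ᶠ t in 𝓝[>] (0 : ℝ), IsGeneric Γ y (fun i => 1 + t * r i) := by
    by_contra hcon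
    rw [not_eventually] at hcon
    have : ∃ᶠ t in 𝓝[>] (0 : ℝ), ∃ G ∈ Γ, G.card < Fintype.card ι ∧
        (fun i => 1 + t * r i) ∈ Submodule.span ℝ (y '' (G : Set W)) := by
      refine hcon.mono fun t ht => ?_
      simpa [IsGeneric] using ht
    rw [frequently_exists_finset] at this
    obtain ⟨G, hG, hfr⟩ := this
    obtain ⟨t, ⟨hc, ht⟩, ht0⟩ := (hfr.and_eventually self_mem_nhdsWithin).exists
    obtain ⟨t', ⟨-, ht'⟩, hlt⟩ := (hfr.and_eventually
      (mem_nhdsWithin_of_mem_nhds (Iio_mem_nhds ht0))).exists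
    apply hr G hG hc
    have := Submodule.smul_mem _ (t - t')⁻¹ (Submodule.sub_mem _ ht ht')
    convert this using 1
    have hne : t - t' ≠ 0 := sub_ne_zero.mpr (ne_of_gt hlt)
    ext i
    simp only [Pi.smul_apply, Pi.sub_apply, smul_eq_mul]
    field_simp
    ring
  obtain ⟨t, h1, h2⟩ := (hgen.and hpos).exists
  exact ⟨_, h1, h2⟩

/-- Every coordinate of a generic vector in a cone is non-zero. -/
theorem IsGeneric.coord_ne_zero (h : SubdividesOrthant Γ y) {w : ι → ℝ} (hw : IsGeneric Γ y w)
    {G : Finset W} (hG : G ∈ Γ) {b : W → ℝ} (hb : ∀ v ∉ G, b v = 0)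
    (hbw : Fintype.linearCombination ℝ y b = w) {v : W} (hv : v ∈ G) : b v ≠ 0 := by
  classical
  intro h0
  refine hw (G.erase v) (h.down G hG _ (Finset.erase_subset _ _)) ?_ ?_
  · rw [Finset.card_erase_of_mem hv]
    have := h.card_le hG
    have := Finset.card_pos.mpr ⟨v, hv⟩
    omega
  · rw [← hbw]
    refine mem_span fun u hu => ?_
    by_cases huv : u = v
    · rw [huv, h0]
    · exact hb u fun huG => hu (Finset.mem_erase.mpr ⟨huv, huG⟩)

/-- If `z` lies in the relative interior of the cone `ρ` and one can move from `z` in the generic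
direction `w` inside the orthant, then one moves into a full-dimensional cone. -/
theorem exists_cone (h : SubdividesOrthant Γ y) {w : ι → ℝ} (hw : IsGeneric Γ y w)
    {ρ : Finset W} (hρ : ρ ∈ Γ) {δ : ℝ} (hδ : 0 < δ)
    (hz : 0 ≤ (∑ v ∈ ρ, y v) + δ • w) :
    ∃ G ∈ Γ, G.card = Fintype.card ι ∧ ρ ⊆ G ∧ ∃ b : W → ℝ, (∀ v ∉ G, b v = 0) ∧
      Fintype.linearCombination ℝ y b = w ∧ ∀ v ∈ G, v ∉ ρ → 0 < b v := by
  classical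
  set L := Fintype.linearCombination ℝ y with hL
  set a : W → ℝ := fun v => if v ∈ ρ then 1 else 0 with ha
  have hLa : L a = ∑ v ∈ ρ, y v := by
    rw [hL, Fintype.linearCombination_apply]
    simp [ha, Finset.sum_ite_mem]
  have hz0 : 0 ≤ ∑ v ∈ ρ, y v := Finset.sum_nonneg fun v hv => h.nonneg ρ hρ v hv
  rw [← hLa] at hz hz0
  have hev : ∀ᶠ ε in 𝓝[>] (0 : ℝ), ∃ G ∈ Γ, ∃ c : W → ℝ, 0 ≤ c ∧ (∀ v ∉ G, c v = 0) ∧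
      L c = L a + ε • w := by
    filter_upwards [self_mem_nhdsWithin, mem_nhdsWithin_of_mem_nhds (Iio_mem_nhds hδ)]
      with ε h0 h1
    refine h.cover _ fun i => ?_
    have e1 := hz i
    have e2 := hz0 i
    simp only [Pi.zero_apply, Pi.add_apply, Pi.smul_apply, smul_eq_mul] at e1 e2 ⊢
    have h0' : (0 : ℝ) < ε := h0
    have h1' : ε < δ := h1
    by_cases hwi : 0 ≤ w i
    · positivity
    · nlinarith
  -- There are finitely many cones, so one `G` contains the moved point for arbitrarily small `ε`.
  -- Two such points recover the coordinates `b` of `w` in `G`.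
  have hfr := hev.frequently
  rw [frequently_exists_finset] at hfr
  obtain ⟨G, hG, hfr⟩ := hfr
  obtain ⟨t, ⟨c, hc0, hcG, hc⟩, ht0⟩ := (hfr.and_eventually self_mem_nhdsWithin).exists
  obtain ⟨t', ⟨c', hc0', hcG', hc'⟩, hlt⟩ := (hfr.and_eventually
      (mem_nhdsWithin_of_mem_nhds (Iio_mem_nhds ht0))).exists
  have hne : t - t' ≠ 0 := sub_ne_zero.mpr (ne_of_gt hlt)
  set b : W → ℝ := (t - t')⁻¹ • (c - c') with hb
  have hbG : ∀ v ∉ G, b v = 0 := by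
    intro v hv; simp [hb, hcG v hv, hcG' v hv]
  have hLb : L b = w := by
    rw [hb, map_smul, map_sub, hc, hc', add_sub_add_left_eq_sub, ← sub_smul, smul_smul,
      inv_mul_cancel₀ hne, one_smul]
  set a' : W → ℝ := c - t • b with ha'
  have haG' : ∀ v ∉ G, a' v = 0 := by
    intro v hv; simp [ha', hbG v hv, hcG v hv]
  have hLa' : L a' = L a := by
    rw [ha', map_sub, map_smul, hLb, hc, add_sub_cancel_right]
  have hfr' : ∃ᶠ ε in 𝓝[>] (0 : ℝ), 0 ≤ a' + ε • b := by
    refine hfr.mono fun ε hε => ?_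
    obtain ⟨d, hd0, hdG, hd⟩ := hε
    have : d = a' + ε • b := h.eq_of_linearCombination_eq hG hdG
      (by intro v hv; simp [haG' v hv, hbG v hv]) (by
        rw [← hL, hd, map_add, map_smul, hLb, hLa'])
    exact this ▸ hd0
  -- Letting `ε → 0` puts the starting point in the cone `G`; uniqueness of coefficients then gives
  -- `a' = a`, and so `ρ ⊆ G`.
  have ha'0 : 0 ≤ a' := by
    intro v
    have ht : Tendsto (fun ε : ℝ => a' v + ε * b v) (𝓝[>] 0) (𝓝 (a' v + 0 * b v)) :=
      (Continuous.tendsto (by fun_prop) 0).mono_left nhdsWithin_le_nhds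
    rw [zero_mul, add_zero] at ht
    exact ge_of_tendsto_of_frequently ht (hfr'.mono fun ε hε => by simpa using hε v)
  have haa : a' = a := h.inj G hG ρ hρ _ _ ha'0
    (by intro v; simp only [ha, Pi.zero_apply]; split_ifs <;> norm_num) haG'
    (by intro v hv; simp [ha, hv]) hLa'
  have hρG : ρ ⊆ G := by
    intro v hv
    by_contra hvG
    have := haG' v hvG
    rw [haa] at this
    simp [ha, hv] at this
  refine ⟨G, hG, ?_, hρG, b, hbG, hLb, ?_⟩
  · by_contra hne
    exact hw G hG (lt_of_le_of_ne (h.card_le hG) hne) (hLb ▸ mem_span hbG)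
  · intro v hv hvρ
    obtain ⟨ε, hε, hε0⟩ := (hfr'.and_eventually self_mem_nhdsWithin).exists
    have h1 := hε v
    have h0 : (0 : ℝ) < ε := hε0
    simp only [haa, ha, hvρ, Pi.zero_apply, Pi.add_apply, Pi.smul_apply, smul_eq_mul, if_false,
      zero_add] at h1
    exact lt_of_le_of_ne (nonneg_of_mul_nonneg_right h1 h0)
      (IsGeneric.coord_ne_zero h hw hG hbG hLb hv).symm

/-- A short move from the interior of `ρ` along `w` ends in both cones, so its coefficients agree
and `b = b'`. Then `w` lies in the span of `G ∩ G'`, which genericity forces to be full-dimensional.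
-/
theorem cone_unique (h : SubdividesOrthant Γ y) {w : ι → ℝ} (hw : IsGeneric Γ y w)
    {ρ G G' : Finset W} (hG : G ∈ Γ) (hG' : G' ∈ Γ) (hρG : ρ ⊆ G) (hρG' : ρ ⊆ G')
    {b b' : W → ℝ} (hb : ∀ v ∉ G, b v = 0) (hb' : ∀ v ∉ G', b' v = 0)
    (hbw : Fintype.linearCombination ℝ y b = w) (hbw' : Fintype.linearCombination ℝ y b' = w)
    (hpos : ∀ v ∈ G, v ∉ ρ → 0 ≤ b v) (hpos' : ∀ v ∈ G', v ∉ ρ → 0 ≤ b' v) : G = G' := by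
  classical
  set a : W → ℝ := fun v => if v ∈ ρ then 1 else 0 with ha
  have hnonneg : ∀ (H : Finset W) (d : W → ℝ), (∀ v ∉ H, d v = 0) →
      (∀ v ∈ H, v ∉ ρ → 0 ≤ d v) → ∀ᶠ ε in 𝓝[>] (0 : ℝ), 0 ≤ a + ε • d := by
    intro H d hd hpd
    have : ∀ᶠ ε in 𝓝[>] (0 : ℝ), ∀ v, 0 ≤ a v + ε * d v := by
      rw [eventually_all]
      intro v
      by_cases hv : v ∈ ρ
      · have ht : Tendsto (fun ε : ℝ => a v + ε * d v) (𝓝[>] 0) (𝓝 (a v + 0 * d v)) :=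
          (Continuous.tendsto (by fun_prop) 0).mono_left nhdsWithin_le_nhds
        exact (ht.eventually_const_lt (u := 0) (by simp [ha, hv])).mono fun _ => le_of_lt
      · filter_upwards [self_mem_nhdsWithin] with ε hε
        have h0 : (0 : ℝ) < ε := hε
        have hdv : 0 ≤ d v := by
          by_cases hvH : v ∈ H
          · exact hpd v hvH hv
          · exact (hd v hvH).ge
        simp only [ha, hv, if_false, zero_add]
        positivity
    exact this.mono fun ε hε v => by simpa using hε v
  obtain ⟨ε, ⟨h1, h2⟩, hε⟩ := (((hnonneg G b hb hpos).and (hnonneg G' b' hb' hpos')).and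
    self_mem_nhdsWithin).exists
  have hε0 : (0 : ℝ) < ε := hε
  have haG : ∀ H : Finset W, ρ ⊆ H → ∀ v ∉ H, a v = 0 := by
    intro H hH v hv
    simp only [ha, ite_eq_right_iff]
    exact fun hvρ => absurd (hH hvρ) hv
  have e := h.inj G hG G' hG' _ _ h1 h2
    (by intro v hv; simp [haG G hρG v hv, hb v hv])
    (by intro v hv; simp [haG G' hρG' v hv, hb' v hv])
    (by simp [hbw, hbw'])
  have hbb : b = b' := by
    have := add_left_cancel e
    exact smul_right_injective _ hε0.ne' this
  have hinter : ∀ v ∉ G ∩ G', b v = 0 := by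
    intro v hv
    by_cases hvG : v ∈ G
    · rw [hbb]; exact hb' v fun hv' => hv (Finset.mem_inter.mpr ⟨hvG, hv'⟩)
    · exact hb v hvG
  have hcard : Fintype.card ι ≤ (G ∩ G').card := by
    by_contra hlt
    exact hw _ (h.down G hG _ Finset.inter_subset_left) (not_le.mp hlt) (hbw ▸ mem_span hinter)
  have e1 := Finset.eq_of_subset_of_card_le (Finset.inter_subset_left (s₁ := G) (s₂ := G'))
    ((h.card_le hG).trans hcard)
  have e2 := Finset.eq_of_subset_of_card_le (Finset.inter_subset_right (s₁ := G) (s₂ := G'))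
    ((h.card_le hG').trans hcard)
  exact e1.symm.trans e2

end SubdividesOrthant
-- Alternating sums, the Euler relation and reciprocity
theorem sum_Icc_neg_one_pow_card {W : Type*} [DecidableEq W] {A G : Finset W} (hAG : A ⊆ G) :
    ∑ ρ ∈ Finset.Icc A G, (-1 : ℝ) ^ ρ.card = if A = G then (-1) ^ G.card else 0 := by
  rw [Finset.Icc_eq_image_powerset hAG, Finset.sum_image]
  · have : ∀ ρ ∈ (G \ A).powerset, (-1 : ℝ) ^ (A ∪ ρ).card
        = (-1) ^ A.card * ((-1 : ℤ) ^ ρ.card : ℤ) := by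
      intro ρ hρ
      rw [Finset.card_union_of_disjoint
        (Finset.disjoint_sdiff.mono_right (Finset.mem_powerset.mp hρ)), pow_add]
      push_cast
      rfl
    rw [Finset.sum_congr rfl this, ← Finset.mul_sum, ← Int.cast_sum,
      Finset.sum_powerset_neg_one_pow_card]
    by_cases e : A = G
    · simp [e]
    · rw [if_neg e, if_neg]
      · simp
      · rw [Finset.sdiff_eq_empty_iff_subset]
        exact fun h => e (hAG.antisymm h)
  · intro ρ hρ ρ' hρ' e
    have h1 := Finset.mem_powerset.mp hρ
    have h2 := Finset.mem_powerset.mp hρ'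
    have e' : A ∪ ρ = A ∪ ρ' := e
    ext v
    have := congrArg (v ∈ ·) e'
    simp only [Finset.mem_union, eq_iff_iff] at this
    have := @h1 v
    have := @h2 v
    simp only [Finset.mem_sdiff] at *
    tauto

namespace SubdividesOrthant

/-- The relative interior of the cone `ρ` lies in the open orthant. -/
def IsInterior {ι W : Type*} (y : W → ι → ℝ) (ρ : Finset W) : Prop :=
  ∀ i, 0 < (∑ v ∈ ρ, y v) i

variable {ι W : Type*} [Fintype W] {Γ : Finset (Finset W)} {y : W → ι → ℝ}

/-- If coordinate `i` vanished on all of `ρ`, then `q i` would be a sum of contributions of `G \ ρ`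
only, all non-positive. -/
theorem isInterior_of_coord_nonpos (h : SubdividesOrthant Γ y) {q : ι → ℝ} (hq : ∀ i, 0 < q i)
    {G ρ : Finset W} (hG : G ∈ Γ) (hρ : ρ ⊆ G) {b : W → ℝ} (hb : ∀ v ∉ G, b v = 0)
    (hbq : Fintype.linearCombination ℝ y b = q) (hN : ∀ v ∈ G, v ∉ ρ → b v ≤ 0) :
    IsInterior y ρ := by
  intro i
  have h0 : ∀ v ∈ ρ, 0 ≤ y v i := fun v hv => h.nonneg G hG v (hρ hv) i
  rw [Finset.sum_apply]
  refine lt_of_le_of_ne (Finset.sum_nonneg h0) fun e => ?_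
  have hz := (Finset.sum_eq_zero_iff_of_nonneg h0).mp e.symm
  have := hq i
  rw [← hbq, Fintype.linearCombination_apply, Finset.sum_apply] at this
  refine absurd this (not_lt.mpr (Finset.sum_nonpos fun v _ => ?_))
  rw [Pi.smul_apply, smul_eq_mul]
  by_cases hvG : v ∈ G
  · by_cases hvρ : v ∈ ρ
    · rw [hz v hvρ, mul_zero]
    · exact mul_nonpos_of_nonpos_of_nonneg (hN v hvG hvρ) (h.nonneg G hG v hvG i)
  · rw [hb v hvG, zero_mul]

variable [Fintype ι]

open Classical in
/-- The Euler relation for the star of a face. -/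
theorem sum_isInterior (h : SubdividesOrthant Γ y) {τ : Finset W} (hτ : τ ∈ Γ) :
    ∑ ρ ∈ Γ with τ ⊆ ρ ∧ IsInterior y ρ, (-1 : ℝ) ^ ρ.card = (-1) ^ Fintype.card ι := by
  obtain ⟨q, hqgen, hq⟩ := h.exists_isGeneric_pos
  have hb : ∀ G : Finset W, ∃ b : W → ℝ, G ∈ Γ → G.card = Fintype.card ι →
      (∀ v ∉ G, b v = 0) ∧ Fintype.linearCombination ℝ y b = q := by
    intro G
    by_cases hG : G ∈ Γ ∧ G.card = Fintype.card ι
    · obtain ⟨b, hb⟩ := h.exists_coord hG.1 hG.2 q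
      exact ⟨b, fun _ _ => hb⟩
    · exact ⟨0, fun h1 h2 => absurd ⟨h1, h2⟩ hG⟩
  choose b hb using hb
  -- `P ρ G` expresses that moving from the relative interior of `ρ` in direction `-q` leads into
  -- the maximal cone `G`. Interior `ρ` can be moved this way inside the orthant, so exactly one `G`
  -- occurs.
  let P : Finset W → Finset W → Prop := fun ρ G =>
    G.card = Fintype.card ι ∧ ρ ⊆ G ∧ ∀ v ∈ G, v ∉ ρ → b G v ≤ 0
  have hP : ∀ ρ ∈ Γ, IsInterior y ρ → (Γ.filter (P ρ)).card = 1 := by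
    intro ρ hρ hint
    obtain ⟨δ, hδ, hz⟩ : ∃ δ : ℝ, 0 < δ ∧ 0 ≤ (∑ v ∈ ρ, y v) + δ • (-q) := by
      have : ∀ᶠ δ in nhdsWithin (0 : ℝ) (Set.Ioi 0), ∀ i, 0 < (∑ v ∈ ρ, y v) i + δ * (-q i) := by
        rw [Filter.eventually_all]
        intro i
        have : Filter.Tendsto (fun t : ℝ => (∑ v ∈ ρ, y v) i + t * (-q i))
            (nhdsWithin (0 : ℝ) (Set.Ioi 0)) (nhds ((∑ v ∈ ρ, y v) i + 0 * (-q i))) :=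
          (Continuous.tendsto (by fun_prop) 0).mono_left nhdsWithin_le_nhds
        exact this.eventually_const_lt (by simpa using hint i)
      obtain ⟨δ, h1, h2⟩ := (this.and self_mem_nhdsWithin).exists
      exact ⟨δ, h2, fun i => (h1 i).le⟩
    obtain ⟨G, hG, hGc, hρG, b', hb', hbq', hpos⟩ := h.exists_cone hqgen.neg hρ hδ hz
    rw [Finset.card_eq_one]
    refine ⟨G, Finset.eq_singleton_iff_unique_mem.mpr ⟨?_, ?_⟩⟩
    · refine Finset.mem_filter.mpr ⟨hG, hGc, hρG, fun v hv hvρ => ?_⟩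
      have : b' = -b G := h.eq_of_linearCombination_eq hG hb'
        (by intro v hv; simp [(hb G hG hGc).1 v hv]) (by rw [hbq', map_neg, (hb G hG hGc).2])
      have h1 := hpos v hv hvρ
      rw [this, Pi.neg_apply] at h1
      linarith
    · intro G' hG'
      obtain ⟨hG'Γ, hG'c, hρG', hneg⟩ := Finset.mem_filter.mp hG'
      refine h.cone_unique hqgen.neg hG'Γ hG hρG' hρG (b := -b G') (b' := b') ?_ hb' ?_ hbq' ?_ ?_
      · intro v hv; simp [(hb G' hG'Γ hG'c).1 v hv]
      · rw [map_neg, (hb G' hG'Γ hG'c).2]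
      · intro v hv hvρ; simpa using hneg v hv hvρ
      · exact fun v hv hvρ => (hpos v hv hvρ).le
  -- `G₀` is entered from `τ` in the opposite direction `+q`, which is always possible in the
  -- orthant.
  obtain ⟨G₀, hG₀, hG₀c, hτG₀, b₀, hb₀, hbq₀, hpos₀⟩ := h.exists_cone hqgen hτ one_pos
    (add_nonneg (Finset.sum_nonneg fun v hv => h.nonneg τ hτ v hv)
      (by rw [one_smul]; exact fun i => (hq i).le))
  have hb₀' : b₀ = b G₀ := h.eq_of_linearCombination_eq hG₀ hb₀ (hb G₀ hG₀ hG₀c).1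
    (by rw [hbq₀, (hb G₀ hG₀ hG₀c).2])
  have hinner : ∀ G ∈ Γ, ∑ ρ ∈ Γ with (τ ⊆ ρ ∧ IsInterior y ρ) ∧ P ρ G, (-1 : ℝ) ^ ρ.card =
      if G = G₀ then (-1) ^ Fintype.card ι else 0 := by
    intro G hG
    by_cases hcond : G.card = Fintype.card ι ∧ τ ⊆ G
    · obtain ⟨hGc, hτG⟩ := hcond
      obtain ⟨hbG, hbq⟩ := hb G hG hGc
      -- Interiority is automatic here, so the condition on `ρ` is only that it contains `τ` and all
      -- rays of positive `q`-coordinate. The alternating sum survives only when this interval is a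
      -- single point, which means `G = G₀`.
      have hset : (Γ.filter fun ρ => (τ ⊆ ρ ∧ IsInterior y ρ) ∧ P ρ G) =
          Finset.Icc (τ ∪ G.filter fun v => 0 < b G v) G := by
        ext ρ
        simp only [Finset.mem_filter, Finset.mem_Icc]
        constructor
        · rintro ⟨-, ⟨hτρ, -⟩, -, hρG, hN⟩
          refine ⟨Finset.union_subset hτρ fun v hv => ?_, hρG⟩
          obtain ⟨hvG, hv0⟩ := Finset.mem_filter.mp hv
          by_contra hvρ
          exact absurd hv0 (not_lt.mpr (hN v hvG hvρ))
        · rintro ⟨h1, hρG⟩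
          have hN : ∀ v ∈ G, v ∉ ρ → b G v ≤ 0 := by
            intro v hvG hvρ
            by_contra hv0
            exact hvρ (h1 (Finset.mem_union_right _
              (Finset.mem_filter.mpr ⟨hvG, not_le.mp hv0⟩)))
          exact ⟨h.down G hG ρ hρG, ⟨Finset.union_subset_left h1,
            h.isInterior_of_coord_nonpos hq hG hρG hbG hbq hN⟩, hGc, hρG, hN⟩
      rw [hset, sum_Icc_neg_one_pow_card
        (Finset.union_subset hτG (Finset.filter_subset _ _)), hGc]
      congr 1
      rw [eq_iff_iff]
      constructor
      · intro e
        refine h.cone_unique hqgen hG hG₀ hτG hτG₀ hbG hb₀ hbq hbq₀ ?_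
          (fun v hv hvτ => (hpos₀ v hv hvτ).le)
        intro v hv hvτ
        rw [← e, Finset.mem_union, Finset.mem_filter] at hv
        exact (hv.resolve_left hvτ).2.le
      · rintro rfl
        refine (Finset.union_subset hτG (Finset.filter_subset _ _)).antisymm fun v hv => ?_
        by_cases hvτ : v ∈ τ
        · exact Finset.mem_union_left _ hvτ
        · exact Finset.mem_union_right _ (Finset.mem_filter.mpr ⟨hv, hb₀' ▸ hpos₀ v hv hvτ⟩)
    · rw [if_neg (by rintro rfl; exact hcond ⟨hG₀c, hτG₀⟩), Finset.sum_eq_zero]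
      intro ρ hρ
      obtain ⟨-, ⟨hτρ, -⟩, hGc, hρG, -⟩ := Finset.mem_filter.mp hρ
      exact absurd ⟨hGc, hτρ.trans hρG⟩ hcond
  calc ∑ ρ ∈ Γ with τ ⊆ ρ ∧ IsInterior y ρ, (-1 : ℝ) ^ ρ.card
      = ∑ ρ ∈ Γ with τ ⊆ ρ ∧ IsInterior y ρ, ∑ G ∈ Γ with P ρ G, (-1 : ℝ) ^ ρ.card := by
        refine Finset.sum_congr rfl fun ρ hρ => ?_
        obtain ⟨hρΓ, -, hint⟩ := Finset.mem_filter.mp hρ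
        rw [Finset.sum_const, hP ρ hρΓ hint, one_smul]
    _ = ∑ G ∈ Γ, ∑ ρ ∈ Γ with (τ ⊆ ρ ∧ IsInterior y ρ) ∧ P ρ G, (-1 : ℝ) ^ ρ.card := by
        refine Finset.sum_comm' fun ρ G => ?_
        simp only [Finset.mem_filter]
        tauto
    _ = (-1) ^ Fintype.card ι := by
        rw [Finset.sum_congr rfl hinner, Finset.sum_ite_eq', if_pos hG₀]

open Classical in
/-- Reciprocity between all faces and interior faces. -/
theorem sum_isInterior_choose (h : SubdividesOrthant Γ y) (i : ℕ) :
    ∑ ρ ∈ Γ with IsInterior y ρ, (-1 : ℝ) ^ ρ.card * (ρ.card.choose i : ℝ) =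
      (-1) ^ Fintype.card ι * ((Γ.filter fun τ => τ.card = i).card : ℝ) := by
  have h1 : ∀ ρ ∈ Γ, (ρ.card.choose i : ℝ) = ∑ τ ∈ Γ with τ.card = i ∧ τ ⊆ ρ, (1 : ℝ) := by
    intro ρ hρ
    rw [Finset.sum_const, nsmul_one, ← Finset.card_powersetCard]
    congr 2
    ext τ
    simp only [Finset.mem_powersetCard, Finset.mem_filter]
    exact ⟨fun ⟨a, b⟩ => ⟨h.down ρ hρ τ a, b, a⟩, fun ⟨_, b, a⟩ => ⟨a, b⟩⟩
  calc ∑ ρ ∈ Γ with IsInterior y ρ, (-1 : ℝ) ^ ρ.card * (ρ.card.choose i : ℝ)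
      = ∑ ρ ∈ Γ with IsInterior y ρ, ∑ τ ∈ Γ with τ.card = i ∧ τ ⊆ ρ, (-1 : ℝ) ^ ρ.card := by
        refine Finset.sum_congr rfl fun ρ hρ => ?_
        rw [h1 ρ (Finset.mem_filter.mp hρ).1, Finset.mul_sum]
        simp
    _ = ∑ τ ∈ Γ with τ.card = i, ∑ ρ ∈ Γ with τ ⊆ ρ ∧ IsInterior y ρ, (-1 : ℝ) ^ ρ.card := by
        refine Finset.sum_comm' fun ρ τ => ?_
        simp only [Finset.mem_filter]
        tauto
    _ = _ := by
        rw [Finset.sum_congr rfl fun τ hτ => h.sum_isInterior (Finset.mem_filter.mp hτ).1,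
          Finset.sum_const, nsmul_eq_mul, mul_comm]

theorem exists_card_eq (h : SubdividesOrthant Γ y) :
    ∃ G ∈ Γ, G.card = Fintype.card ι := by
  obtain ⟨q, hqgen, hq⟩ := h.exists_isGeneric_pos
  obtain ⟨G, hG, c, -, hcG, hc⟩ := h.cover q fun i => (hq i).le
  refine ⟨G, hG, ?_⟩
  by_contra hne
  exact hqgen G hG (lt_of_le_of_ne (h.card_le hG) hne) (hc ▸ mem_span hcG)

end SubdividesOrthant
/-! ### Barycentric coordinates in a realization -/

section Realization

theorem empty_mem_allFaces {V : Type*} (Δ : PreAbstractSimplicialComplex V) : ∅ ∈ allFaces Δ :=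
  Set.mem_insert _ _

theorem mem_allFaces_of_subset {V : Type*} {Δ : PreAbstractSimplicialComplex V} {σ τ : Finset V}
    (hσ : σ ∈ allFaces Δ) (h : τ ⊆ σ) : τ ∈ allFaces Δ := by
  rcases τ.eq_empty_or_nonempty with rfl | hne
  · exact empty_mem_allFaces Δ
  · rcases hσ with rfl | hσ
    · rw [Finset.subset_empty.mp h]; exact empty_mem_allFaces Δ
    · exact Or.inr ((Δ.isRelLowerSet_faces hσ).2 h hne)

variable {V E : Type*} [Fintype V] [AddCommGroup E] [Module ℝ E]
  {Δ : PreAbstractSimplicialComplex V} {x : V → E}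

theorem mem_convexHull_image_iff (x : V → E) (s : Set V) (z : E) :
    z ∈ convexHull ℝ (x '' s) ↔ ∃ c : V → ℝ, 0 ≤ c ∧ (∀ v ∉ s, c v = 0) ∧ ∑ v, c v = 1 ∧
      ∑ v, c v • x v = z := by
  classical
  constructor
  · intro hz
    refine convexHull_min (t := {z | ∃ c : V → ℝ, 0 ≤ c ∧ (∀ v ∉ s, c v = 0) ∧ ∑ v, c v = 1 ∧
      ∑ v, c v • x v = z}) ?_ ?_ hz
    · rintro _ ⟨v, hv, rfl⟩
      refine ⟨Pi.single v 1, Pi.single_nonneg.mpr zero_le_one, ?_, by simp, ?_⟩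
      · intro u hu
        exact Pi.single_eq_of_ne (by rintro rfl; exact hu hv) _
      · simp [Pi.single_apply]
    · rintro _ ⟨c, h0, hs, h1, rfl⟩ _ ⟨c', h0', hs', h1', rfl⟩ a b ha hb hab
      refine ⟨a • c + b • c', add_nonneg (smul_nonneg ha h0) (smul_nonneg hb h0'), ?_, ?_, ?_⟩
      · intro v hv; simp [hs v hv, hs' v hv]
      · simp [Finset.sum_add_distrib, ← Finset.mul_sum, h1, h1', hab]
      · simp [Finset.sum_add_distrib, Finset.smul_sum, add_smul, mul_smul]
  · rintro ⟨c, h0, hs, h1, rfl⟩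
    have hsum : ∑ v ∈ Finset.univ.filter (· ∈ s), c v = 1 := by
      rw [← h1]
      exact Finset.sum_subset (Finset.subset_univ _) fun v _ hv => hs v (by simpa using hv)
    rw [← Finset.sum_subset (Finset.subset_univ (Finset.univ.filter (· ∈ s)))
      fun v _ hv => by rw [hs v (by simpa using hv), zero_smul]]
    exact (convex_convexHull ℝ _).sum_mem (fun v _ => h0 v) hsum fun v hv =>
      subset_convexHull ℝ _ ⟨v, by simpa using hv, rfl⟩

theorem mem_simplex_iff (x : V → E) (σ : Finset V) (z : E) :
    z ∈ simplex x σ ↔ ∃ c : V → ℝ, 0 ≤ c ∧ (∀ v ∉ σ, c v = 0) ∧ ∑ v, c v = 1 ∧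
      ∑ v, c v • x v = z := by
  simpa [simplex] using mem_convexHull_image_iff x (σ : Set V) z

namespace IsRealization

theorem eq_of_sum_eq (hx : IsRealization Δ x) {σ : Finset V} (hσ : σ ∈ allFaces Δ)
    {c c' : V → ℝ} (hc : ∀ v ∉ σ, c v = 0) (hc' : ∀ v ∉ σ, c' v = 0)
    (h1 : ∑ v, c v = ∑ v, c' v) (h2 : ∑ v, c v • x v = ∑ v, c' v • x v) : c = c' := by
  have hind := affineIndependent_iff.mp (hx.indep σ hσ) Finset.univ (fun v => c v - c' v)
    (by
      rw [Finset.sum_coe_sort σ (fun v => c v - c' v),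
        Finset.sum_subset (Finset.subset_univ σ) fun v _ hv => by rw [hc v hv, hc' v hv, sub_zero],
        Finset.sum_sub_distrib, h1, sub_self])
    (by
      rw [Finset.sum_coe_sort σ (fun v => (c v - c' v) • x v),
        Finset.sum_subset (Finset.subset_univ σ) fun v _ hv => by
          rw [hc v hv, hc' v hv, sub_zero, zero_smul]]
      simp_rw [sub_smul]
      rw [Finset.sum_sub_distrib, h2, sub_self])
  ext v
  by_cases hv : v ∈ σ
  · exact sub_eq_zero.mp (hind ⟨v, hv⟩ (Finset.mem_univ _))
  · rw [hc v hv, hc' v hv]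

/-- Non-negative weights supported on faces are determined by their sum and the point. -/
theorem weights_unique (hx : IsRealization Δ x) {σ σ' : Finset V} (hσ : σ ∈ allFaces Δ)
    (hσ' : σ' ∈ allFaces Δ) {c c' : V → ℝ} (h0 : 0 ≤ c) (h0' : 0 ≤ c')
    (hc : ∀ v ∉ σ, c v = 0) (hc' : ∀ v ∉ σ', c' v = 0)
    (h1 : ∑ v, c v = ∑ v, c' v) (h2 : ∑ v, c v • x v = ∑ v, c' v • x v) : c = c' := by
  rcases (Finset.sum_nonneg fun v (_ : v ∈ Finset.univ) => h0 v).eq_or_lt with ht | ht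
  · have e1 := (Finset.sum_eq_zero_iff_of_nonneg fun v _ => h0 v).mp ht.symm
    have e2 := (Finset.sum_eq_zero_iff_of_nonneg fun v _ => h0' v).mp (h1 ▸ ht.symm)
    ext v
    rw [e1 v (Finset.mem_univ _), e2 v (Finset.mem_univ _)]
  · set t := ∑ v, c v with ht'
    have hmem : ∀ (ρ : Finset V) (d : V → ℝ), 0 ≤ d → (∀ v ∉ ρ, d v = 0) → ∑ v, d v = t →
        t⁻¹ • ∑ v, d v • x v ∈ simplex x ρ := by
      intro ρ d hd hdρ hdt
      rw [mem_simplex_iff]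
      refine ⟨t⁻¹ • d, smul_nonneg (inv_nonneg.mpr ht.le) hd, ?_, ?_, ?_⟩
      · intro v hv; simp [hdρ v hv]
      · simp [← Finset.mul_sum, hdt, ht.ne']
      · simp [Finset.smul_sum, mul_smul]
    -- The common point has weights `d` supported on `σ ∩ σ'`; both `c` and `c'` are compared with
    -- `t • d`, each inside one affinely independent face.
    have hz : t⁻¹ • ∑ v, c v • x v ∈ simplex x σ ∩ simplex x σ' :=
      ⟨hmem σ c h0 hc rfl, h2 ▸ hmem σ' c' h0' hc' h1.symm⟩
    rw [hx.inter σ hσ σ' hσ', mem_convexHull_image_iff] at hz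
    obtain ⟨d, hd0, hd, hd1, hdz⟩ := hz
    have hsum : ∑ v, (t • d) v = t := by simp [← Finset.mul_sum, hd1]
    have hpt : ∑ v, (t • d) v • x v = ∑ v, c v • x v := by
      simp only [Pi.smul_apply, smul_eq_mul, mul_smul]
      rw [← Finset.smul_sum, hdz, smul_smul, mul_inv_cancel₀ ht.ne', one_smul]
    have e1 : t • d = c := hx.eq_of_sum_eq hσ
      (fun v hv => by simp [hd v fun h => hv h.1]) hc hsum hpt
    have e2 : t • d = c' := hx.eq_of_sum_eq hσ'
      (fun v hv => by simp [hd v fun h => hv h.2]) hc' (hsum.trans h1) (hpt.trans h2)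
    exact e1.symm.trans e2

end IsRealization

end Realization

/-! ### Carriers of the faces of a subdivision -/

open Classical in
/-- All faces of a complex on a finite ground set, as a finite set. -/
noncomputable def faceFinset {V : Type*} [Fintype V] (Δ : PreAbstractSimplicialComplex V) :
    Finset (Finset V) :=
  Finset.univ.filter (· ∈ allFaces Δ)

theorem mem_faceFinset {V : Type*} [Fintype V] {Δ : PreAbstractSimplicialComplex V}
    {σ : Finset V} : σ ∈ faceFinset Δ ↔ σ ∈ allFaces Δ := by
  simp [faceFinset]

open Classical in
/-- The support of the barycentric coordinates `Y` on the face `τ`. -/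
noncomputable def carrier {V W : Type*} [Fintype V] (Y : W → V → ℝ) (τ : Finset W) : Finset V :=
  Finset.univ.filter fun v => ∃ w ∈ τ, Y w v ≠ 0

theorem carrier_subset_iff {V W : Type*} [Fintype V] {Y : W → V → ℝ} {τ : Finset W}
    {σ : Finset V} : carrier Y τ ⊆ σ ↔ ∀ w ∈ τ, ∀ v ∉ σ, Y w v = 0 := by
  constructor
  · intro h w hw v hv
    by_contra hne
    exact hv (h (Finset.mem_filter.mpr ⟨Finset.mem_univ _, w, hw, hne⟩))
  · intro h v hv
    obtain ⟨-, w, hw, hne⟩ := Finset.mem_filter.mp hv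
    by_contra hvσ
    exact hne (h w hw v hvσ)

-- `Y w` consists of the barycentric coordinates in `Δ` of the vertex `y w`, with value `0` if `w`
-- is not a vertex of `Δ'`. Points of `|σ|`, rescaled, are the non-zero vectors of the orthant of
-- `ℝ^σ`, so the simplices of `Δ'` inside `|σ|` become the cones of a fan.
open Classical in
theorem exists_barycentric {V W E : Type*} [Fintype V] [Fintype W] [AddCommGroup E] [Module ℝ E]
    {Δ : PreAbstractSimplicialComplex V} {Δ' : PreAbstractSimplicialComplex W}
    {x : V → E} {y : W → E} (hx : IsRealization Δ x) (hy : IsRealization Δ' y)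
    (hspace : space Δ x = space Δ' y)
    (hunion : ∀ σ ∈ allFaces Δ, ∃ S ⊆ allFaces Δ', simplex x σ = ⋃ τ ∈ S, simplex y τ) :
    ∃ Y : W → V → ℝ,
      (∀ τ ∈ allFaces Δ', carrier Y τ ∈ allFaces Δ) ∧
      (∀ τ ∈ allFaces Δ', ∀ σ ∈ allFaces Δ,
        (simplex y τ ⊆ simplex x σ ↔ carrier Y τ ⊆ σ)) ∧
      (∀ w, 0 ≤ Y w) ∧
      ∀ σ ∈ allFaces Δ, SubdividesOrthant ((faceFinset Δ').filter fun τ => carrier Y τ ⊆ σ)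
        (fun w (i : σ) => Y w i) := by
  have hvert : ∀ w, ∃ a : V → ℝ, 0 ≤ a ∧ ({w} ∈ allFaces Δ' → ∑ v, a v = 1 ∧
      ∑ v, a v • x v = y w ∧ ∃ σ ∈ allFaces Δ, ∀ v ∉ σ, a v = 0) := by
    intro w
    by_cases hw : {w} ∈ allFaces Δ'
    · have : y w ∈ space Δ x := by
        rw [hspace]
        exact Set.mem_biUnion hw (subset_convexHull ℝ _ ⟨w, by simp, rfl⟩)
      obtain ⟨σ, hσ, hz⟩ := Set.mem_iUnion₂.mp this
      obtain ⟨a, h0, hs, h1, h2⟩ := (mem_simplex_iff x σ _).mp hz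
      exact ⟨a, h0, fun _ => ⟨h1, h2, σ, hσ, hs⟩⟩
    · exact ⟨0, le_rfl, fun h => absurd h hw⟩
  choose Y hY0 hY using hvert
  have hY' : ∀ τ ∈ allFaces Δ', ∀ w ∈ τ, ∑ v, Y w v = 1 ∧ ∑ v, Y w v • x v = y w ∧
      ∃ σ ∈ allFaces Δ, ∀ v ∉ σ, Y w v = 0 := fun τ hτ w hw =>
    hY w (mem_allFaces_of_subset hτ (Finset.singleton_subset_iff.mpr hw))
  have hpoint : ∀ τ ∈ allFaces Δ', ∀ c : W → ℝ, (∀ w ∉ τ, c w = 0) →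
      (∑ v, (∑ w, c w * Y w v) = ∑ w, c w ∧
        ∑ v, (∑ w, c w * Y w v) • x v = ∑ w, c w • y w) := by
    intro τ hτ c hc
    constructor
    · rw [Finset.sum_comm]
      refine Finset.sum_congr rfl fun w _ => ?_
      rw [← Finset.mul_sum]
      by_cases hw : w ∈ τ
      · rw [(hY' τ hτ w hw).1, mul_one]
      · rw [hc w hw, zero_mul]
    · simp_rw [Finset.sum_smul]
      rw [Finset.sum_comm]
      refine Finset.sum_congr rfl fun w _ => ?_
      simp_rw [mul_smul]
      rw [← Finset.smul_sum]
      by_cases hw : w ∈ τ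
      · rw [(hY' τ hτ w hw).2.1]
      · rw [hc w hw, zero_smul, zero_smul]
  have hsub : ∀ τ ∈ allFaces Δ', ∀ σ ∈ allFaces Δ,
      (simplex y τ ⊆ simplex x σ ↔ carrier Y τ ⊆ σ) := by
    intro τ hτ σ hσ
    rw [carrier_subset_iff]
    constructor
    · intro h w hw v hv
      obtain ⟨h1, h2, σ', hσ', h3⟩ := hY' τ hτ w hw
      have : y w ∈ simplex x σ := h (subset_convexHull ℝ _ ⟨w, hw, rfl⟩)
      obtain ⟨a, h0, hs, h1', h2'⟩ := (mem_simplex_iff x σ _).mp this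
      rw [hx.weights_unique hσ' hσ (hY0 w) h0 h3 hs (h1.trans h1'.symm) (h2.trans h2'.symm)]
      exact hs v hv
    · intro h
      refine convexHull_min ?_ (convex_convexHull ℝ _)
      rintro _ ⟨w, hw, rfl⟩
      obtain ⟨h1, h2, -⟩ := hY' τ hτ w hw
      exact (mem_simplex_iff x σ _).mpr ⟨Y w, hY0 w, h w hw, h1, h2⟩
  have hsum0 : ∀ σ : Finset V, ∀ τ : Finset W, carrier Y τ ⊆ σ → ∀ c : W → ℝ,
      (∀ w ∉ τ, c w = 0) → ∀ v ∉ σ, ∑ w, c w * Y w v = 0 := by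
    intro σ τ hτσ c hc v hv
    refine Finset.sum_eq_zero fun w _ => ?_
    by_cases hw : w ∈ τ
    · rw [carrier_subset_iff.mp hτσ w hw v hv, mul_zero]
    · rw [hc w hw, zero_mul]
  refine ⟨Y, ?_, hsub, hY0, ?_⟩
  · intro τ hτ
    rcases τ.eq_empty_or_nonempty with rfl | hne
    · simpa [carrier] using empty_mem_allFaces Δ
    have hcard : (0 : ℝ) < τ.card := by exact_mod_cast hne.card_pos
    -- The barycentre of `τ` lies in some `|σ|`, hence in some `|τ'| ⊆ |σ|`. All its weights on `τ`
    -- are non-zero, so uniqueness of weights gives `τ ⊆ τ'` and the carrier of `τ` lies in `σ`.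
    set c : W → ℝ := fun w => if w ∈ τ then (τ.card : ℝ)⁻¹ else 0 with hc
    have hc0 : 0 ≤ c := by
      intro w; simp only [hc, Pi.zero_apply]; split_ifs <;> positivity
    have hcτ : ∀ w ∉ τ, c w = 0 := by intro w hw; simp [hc, hw]
    have hc1 : ∑ w, c w = 1 := by
      simp [hc, Finset.sum_ite_mem, hcard.ne']
    have hz : ∑ w, c w • y w ∈ simplex y τ := (mem_simplex_iff y τ _).mpr ⟨c, hc0, hcτ, hc1, rfl⟩
    have : ∑ w, c w • y w ∈ space Δ x := hspace ▸ Set.mem_biUnion hτ hz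
    obtain ⟨σ, hσ, hzσ⟩ := Set.mem_iUnion₂.mp this
    obtain ⟨S, hS, e⟩ := hunion σ hσ
    rw [e] at hzσ
    obtain ⟨τ', hτ'S, hz'⟩ := Set.mem_iUnion₂.mp hzσ
    obtain ⟨c', h0', hs', h1', h2'⟩ := (mem_simplex_iff y τ' _).mp hz'
    have hcc := hy.weights_unique hτ (hS hτ'S) hc0 h0' hcτ hs' (hc1.trans h1'.symm) h2'.symm
    have hττ' : τ ⊆ τ' := by
      intro w hw
      by_contra hw'
      have := hs' w hw'
      rw [← hcc] at this
      simp [hc, hw, hcard.ne'] at this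
    have : carrier Y τ' ⊆ σ := (hsub τ' (hS hτ'S) σ hσ).mp
      (e ▸ Set.subset_biUnion_of_mem (u := fun τ => simplex y τ) hτ'S)
    refine mem_allFaces_of_subset hσ ((carrier_subset_iff.mpr ?_))
    intro w hw
    exact carrier_subset_iff.mp this w (hττ' hw)
  · intro σ hσ
    have hL : ∀ (c : W → ℝ) (i : σ), Fintype.linearCombination ℝ (fun w (i : σ) => Y w i) c i =
        ∑ w, c w * Y w i := by
      intro c i
      simp [Fintype.linearCombination_apply]
    refine ⟨?_, ?_, ?_, ?_⟩
    · intro G hG ρ hρ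
      rw [Finset.mem_filter, mem_faceFinset, carrier_subset_iff] at hG ⊢
      exact ⟨mem_allFaces_of_subset hG.1 hρ, fun w hw => hG.2 w (hρ hw)⟩
    · exact fun G hG w hw i => hY0 w i
    · intro G hG G' hG' c c' h0 h0' hc hc' e
      rw [Finset.mem_filter, mem_faceFinset] at hG hG'
      have heq : ∀ v, ∑ w, c w * Y w v = ∑ w, c' w * Y w v := by
        intro v
        by_cases hv : v ∈ σ
        · have := congrFun e ⟨v, hv⟩
          rwa [hL, hL] at this
        · rw [hsum0 σ G hG.2 c hc v hv, hsum0 σ G' hG'.2 c' hc' v hv]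
      obtain ⟨p1, p2⟩ := hpoint G hG.1 c hc
      obtain ⟨p1', p2'⟩ := hpoint G' hG'.1 c' hc'
      simp_rw [heq] at p1 p2
      exact hy.weights_unique hG.1 hG'.1 h0 h0' hc hc' (p1.symm.trans p1') (p2.symm.trans p2')
    · intro z hz
      set a : V → ℝ := fun v => if hv : v ∈ σ then z ⟨v, hv⟩ else 0 with ha
      have ha0 : 0 ≤ a := by
        intro v
        simp only [ha, Pi.zero_apply]
        split_ifs with hv
        · exact hz _
        · exact le_rfl
      have haσ : ∀ v ∉ σ, a v = 0 := by intro v hv; simp [ha, hv]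
      have haz : ∀ i : σ, a i = z i := by intro i; simp [ha]
      rcases (Finset.sum_nonneg fun v (_ : v ∈ Finset.univ) => ha0 v).eq_or_lt with ht | ht
      · have e1 := (Finset.sum_eq_zero_iff_of_nonneg fun v _ => ha0 v).mp ht.symm
        -- The origin cannot be rescaled into `|σ|`; it is the cone of the empty face.
        refine ⟨∅, ?_, 0, le_rfl, by simp, ?_⟩
        · rw [Finset.mem_filter, mem_faceFinset, carrier_subset_iff]
          exact ⟨empty_mem_allFaces Δ', by simp⟩
        · ext i
          rw [hL, ← haz, e1 i (Finset.mem_univ _)]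
          simp
      · set t := ∑ v, a v with htdef
        have hmem : t⁻¹ • ∑ v, a v • x v ∈ simplex x σ := by
          refine (mem_simplex_iff x σ _).mpr
            ⟨t⁻¹ • a, smul_nonneg (inv_nonneg.mpr ht.le) ha0, ?_, ?_, ?_⟩
          · intro v hv; simp [haσ v hv]
          · simp [← Finset.mul_sum, ← htdef, ht.ne']
          · simp [Finset.smul_sum, mul_smul]
        obtain ⟨S, hS, e⟩ := hunion σ hσ
        rw [e] at hmem
        obtain ⟨τ, hτS, hzτ⟩ := Set.mem_iUnion₂.mp hmem
        have hτσ : carrier Y τ ⊆ σ := (hsub τ (hS hτS) σ hσ).mp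
          (e ▸ Set.subset_biUnion_of_mem (u := fun τ => simplex y τ) hτS)
        obtain ⟨c, h0, hs, h1, h2⟩ := (mem_simplex_iff y τ _).mp hzτ
        have hs' : ∀ w ∉ τ, (t • c) w = 0 := by intro w hw; simp [hs w hw]
        refine ⟨τ, ?_, t • c, smul_nonneg ht.le h0, hs', ?_⟩
        · rw [Finset.mem_filter, mem_faceFinset]
          exact ⟨hS hτS, hτσ⟩
        · obtain ⟨p1, p2⟩ := hpoint τ (hS hτS) (t • c) hs'
          have key : (fun v => ∑ w, (t • c) w * Y w v) = a := by
            refine hx.eq_of_sum_eq hσ (hsum0 σ τ hτσ _ hs') haσ ?_ ?_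
            · rw [p1, ← htdef]
              simp [← Finset.mul_sum, h1]
            · rw [p2]
              simp only [Pi.smul_apply, smul_eq_mul, mul_smul]
              rw [← Finset.smul_sum, h2, smul_smul, mul_inv_cancel₀ ht.ne', one_smul]
          ext i
          rw [hL, ← haz]
          exact congrFun key i

/-! ### Enumerating faces by their carriers -/

open Classical in
/-- The combinatorial data of a face uniform subdivision with array `F`: `carr τ` is the smallest
face of the subdivided complex `S` which contains the face `τ` of the subdivision `T`. -/
structure IsCarrierMap {V W : Type*} (F : ℕ → ℕ → ℕ) (S : Finset (Finset V))
    (T : Finset (Finset W)) (carr : Finset W → Finset V) : Prop where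
  mem : ∀ τ ∈ T, carr τ ∈ S
  count : ∀ σ ∈ S, ∀ i, (T.filter fun τ => carr τ ⊆ σ ∧ τ.card = i).card = simplexCount F i σ.card
  euler : ∀ σ ∈ S, ∀ i, ∑ τ ∈ T with carr τ = σ, (-1 : ℝ) ^ τ.card * (τ.card.choose i : ℝ) =
    (-1) ^ σ.card * (simplexCount F i σ.card : ℝ)
  card_le : ∀ τ ∈ T, τ.card ≤ (carr τ).card
  exists_card : ∀ σ ∈ S, ∃ τ ∈ T, carr τ ⊆ σ ∧ τ.card = σ.card

open Classical in
theorem IsFaceUniformSubdivision.exists_isCarrierMap {V W E : Type*} [Fintype V] [Fintype W]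
    [AddCommGroup E] [Module ℝ E] {F : ℕ → ℕ → ℕ} {Δ : PreAbstractSimplicialComplex V}
    {Δ' : PreAbstractSimplicialComplex W} (h : IsFaceUniformSubdivision E F Δ Δ') :
    ∃ carr, IsCarrierMap F (faceFinset Δ) (faceFinset Δ') carr := by
  obtain ⟨x, y, hx, hy, hspace, hunion, hcount⟩ := h
  obtain ⟨Y, hmem, hsub, hY0, hO⟩ := exists_barycentric hx hy hspace hunion
  have hle : ∀ τ ∈ allFaces Δ', ∀ σ ∈ allFaces Δ, carrier Y τ ⊆ σ → τ.card ≤ σ.card := by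
    intro τ hτ σ hσ hτσ
    simpa using (hO σ hσ).card_le (Finset.mem_filter.mpr ⟨mem_faceFinset.mpr hτ, hτσ⟩)
  have hcnt : ∀ σ ∈ allFaces Δ, ∀ i, ((faceFinset Δ').filter fun τ =>
      carrier Y τ ⊆ σ ∧ τ.card = i).card = simplexCount F i σ.card := by
    intro σ hσ i
    rw [simplexCount]
    split_ifs with h0 h1
    · rw [Finset.card_eq_one]
      refine ⟨∅, Finset.eq_singleton_iff_unique_mem.mpr ⟨?_, ?_⟩⟩
      · rw [Finset.mem_filter, mem_faceFinset, carrier_subset_iff]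
        exact ⟨empty_mem_allFaces Δ', by simp, by simp [h0]⟩
      · intro τ hτ
        exact Finset.card_eq_zero.mp ((Finset.mem_filter.mp hτ).2.2.trans h0)
    · rw [← hcount (i - 1) (σ.card - 1) (by omega) σ hσ (by omega), ← Set.ncard_coe_finset]
      congr 1
      ext τ
      simp only [Finset.coe_filter, mem_faceFinset, Set.mem_ofPred_eq]
      constructor
      · rintro ⟨a, b, c⟩
        exact ⟨a, (hsub τ a σ hσ).mpr b, by omega⟩
      · rintro ⟨a, b, c⟩
        exact ⟨a, (hsub τ a σ hσ).mp b, by omega⟩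
    · rw [Finset.card_eq_zero, Finset.filter_eq_empty_iff]
      rintro τ hτ ⟨h2, h3⟩
      have := hle τ (mem_faceFinset.mp hτ) σ hσ h2
      omega
  refine ⟨carrier Y, ?_, ?_, ?_, ?_, ?_⟩
  · exact fun τ hτ => mem_faceFinset.mpr (hmem τ (mem_faceFinset.mp hτ))
  · exact fun σ hσ => hcnt σ (mem_faceFinset.mp hσ)
  · intro σ hσ i
    rw [mem_faceFinset] at hσ
    have key := (hO σ hσ).sum_isInterior_choose i
    rw [Fintype.card_coe, Finset.filter_filter, Finset.filter_filter, hcnt σ hσ i] at key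
    rw [← key]
    refine Finset.sum_congr (Finset.filter_congr fun τ hτ => ?_) fun _ _ => rfl
    -- The coordinates are non-negative, so a coordinate of the sum is positive exactly when some
    -- vertex of `τ` has it non-zero.
    have hint : SubdividesOrthant.IsInterior (fun w (i : σ) => Y w i) τ ↔ σ ⊆ carrier Y τ := by
      have h0 : ∀ i : σ, (∑ w ∈ τ, fun i : σ => Y w i) i = ∑ w ∈ τ, Y w i := fun i => by simp
      simp only [SubdividesOrthant.IsInterior, h0]
      constructor
      · intro h v hv
        obtain ⟨w, hw, hpos⟩ := Finset.exists_ne_zero_of_sum_ne_zero (h ⟨v, hv⟩).ne'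
        exact Finset.mem_filter.mpr ⟨Finset.mem_univ _, w, hw, hpos⟩
      · intro h i
        obtain ⟨-, w, hw, hne⟩ := Finset.mem_filter.mp (h i.2)
        exact Finset.sum_pos' (fun w _ => hY0 w i) ⟨w, hw, lt_of_le_of_ne (hY0 w i) hne.symm⟩
    rw [hint]
    exact ⟨fun e => ⟨e.le, e.ge⟩, fun e => e.1.antisymm e.2⟩
  · intro τ hτ
    rw [mem_faceFinset] at hτ
    exact hle τ hτ _ (hmem τ hτ) le_rfl
  · intro σ hσ
    rw [mem_faceFinset] at hσ
    obtain ⟨τ, hτ, e⟩ := (hO σ hσ).exists_card_eq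
    obtain ⟨h1, h2⟩ := Finset.mem_filter.mp hτ
    exact ⟨τ, h1, h2, by simpa using e⟩

/-! ### Counting faces through the carrier map -/

namespace IsCarrierMap

variable {V W : Type*} {F : ℕ → ℕ → ℕ} {S : Finset (Finset V)} {T : Finset (Finset W)}
  {carr : Finset W → Finset V}

-- Möbius inversion on the Boolean lattice of faces of `σ`: after exchanging sums, `τ` contributes
-- an alternating sum over the interval from `carr τ` to `σ`.
open Classical in
theorem interiorCount_eq (h : IsCarrierMap F S T carr) (hS : ∀ σ ∈ S, ∀ τ ⊆ σ, τ ∈ S)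
    {σ : Finset V} (hσ : σ ∈ S) (i : ℕ) :
    interiorCount F i σ.card = ((T.filter fun τ => carr τ = σ ∧ τ.card = i).card : ℝ) := by
  have h1 := Finset.sum_powerset_apply_card (x := σ)
    (fun k => (-1 : ℝ) ^ (σ.card - k) * (simplexCount F i k : ℝ))
  have h2 : interiorCount F i σ.card =
      ∑ ρ ∈ σ.powerset, (-1 : ℝ) ^ (σ.card - ρ.card) * (simplexCount F i ρ.card : ℝ) := by
    rw [h1, interiorCount]
    refine Finset.sum_congr rfl fun k _ => ?_
    rw [nsmul_eq_mul]
    ring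
  rw [h2]
  calc ∑ ρ ∈ σ.powerset, (-1 : ℝ) ^ (σ.card - ρ.card) * (simplexCount F i ρ.card : ℝ)
      = ∑ ρ ∈ σ.powerset, ∑ τ ∈ T with carr τ ⊆ ρ ∧ τ.card = i,
          (-1) ^ σ.card * (-1 : ℝ) ^ ρ.card := by
        refine Finset.sum_congr rfl fun ρ hρ => ?_
        have hρσ := Finset.mem_powerset.mp hρ
        rw [Finset.sum_const, h.count ρ (hS σ hσ ρ hρσ) i, nsmul_eq_mul, mul_comm]
        congr 1
        have := Finset.card_le_card hρσ
        obtain ⟨m, hm⟩ := Nat.exists_eq_add_of_le this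
        rw [hm, Nat.add_sub_cancel_left, pow_add, mul_comm, ← mul_assoc, ← pow_add,
          Even.neg_one_pow ⟨_, rfl⟩, one_mul]
    _ = ∑ τ ∈ T with carr τ ⊆ σ ∧ τ.card = i, ∑ ρ ∈ Finset.Icc (carr τ) σ,
          (-1) ^ σ.card * (-1 : ℝ) ^ ρ.card := by
        refine Finset.sum_comm' fun ρ τ => ?_
        simp only [Finset.mem_filter, Finset.mem_powerset, Finset.mem_Icc]
        constructor
        · rintro ⟨a, b, c, d⟩
          exact ⟨⟨c, a⟩, b, c.trans a, d⟩
        · rintro ⟨⟨a, b⟩, c, -, d⟩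
          exact ⟨b, c, a, d⟩
    _ = ∑ τ ∈ T with carr τ ⊆ σ ∧ τ.card = i, if carr τ = σ then (1 : ℝ) else 0 := by
        refine Finset.sum_congr rfl fun τ hτ => ?_
        rw [← Finset.mul_sum, sum_Icc_neg_one_pow_card (Finset.mem_filter.mp hτ).2.1, mul_ite,
          mul_zero, ← pow_add, Even.neg_one_pow ⟨_, rfl⟩]
    _ = _ := by
        rw [← Finset.sum_filter, Finset.sum_const, nsmul_one, Finset.filter_filter]
        congr 2
        refine Finset.filter_congr fun τ _ => ?_
        constructor
        · rintro ⟨⟨-, b⟩, c⟩; exact ⟨c, b⟩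
        · rintro ⟨a, b⟩; exact ⟨⟨a.le, b⟩, a⟩

/-- The transformation of `f`-vectors. -/
theorem card_filter_eq (h : IsCarrierMap F S T carr) (hS : ∀ σ ∈ S, ∀ τ ⊆ σ, τ ∈ S)
    {d : ℕ} (hd : ∀ σ ∈ S, σ.card ≤ d) (i : ℕ) :
    ((T.filter fun τ => τ.card = i).card : ℝ) =
      ∑ j ∈ Finset.range (d + 1), interiorCount F i j * ((S.filter fun σ => σ.card = j).card : ℝ) := by
  classical
  rw [Finset.card_eq_sum_card_fiberwise (f := carr) (t := S)
    (fun τ hτ => h.mem τ (Finset.mem_filter.mp hτ).1), Nat.cast_sum]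
  calc _ = ∑ σ ∈ S, interiorCount F i σ.card := by
        refine Finset.sum_congr rfl fun σ hσ => ?_
        rw [h.interiorCount_eq hS hσ, Finset.filter_filter]
        congr 2
        exact Finset.filter_congr fun τ _ => and_comm
    _ = ∑ j ∈ Finset.range (d + 1), ∑ σ ∈ S with σ.card = j, interiorCount F i σ.card :=
        (Finset.sum_fiberwise_of_maps_to
          (fun σ hσ => Finset.mem_range.mpr (Nat.lt_succ_of_le (hd σ hσ))) _).symm
    _ = _ := by
        refine Finset.sum_congr rfl fun j _ => ?_
        rw [Finset.sum_congr rfl (g := fun _ => interiorCount F i j)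
          fun σ hσ => by rw [(Finset.mem_filter.mp hσ).2], Finset.sum_const, nsmul_eq_mul, mul_comm]

/-- Reciprocity for the numbers of interior faces. -/
theorem sum_choose_mul_interiorCount (h : IsCarrierMap F S T carr)
    (hS : ∀ σ ∈ S, ∀ τ ⊆ σ, τ ∈ S) {σ : Finset V} (hσ : σ ∈ S) {d : ℕ} (hd : σ.card ≤ d)
    (i : ℕ) :
    ∑ k ∈ Finset.range (d + 1), (-1 : ℝ) ^ k * (k.choose i : ℝ) * interiorCount F k σ.card =
      (-1) ^ σ.card * (simplexCount F i σ.card : ℝ) := by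
  classical
  rw [← h.euler σ hσ i, ← Finset.sum_fiberwise_of_maps_to (g := Finset.card)
    (t := Finset.range (d + 1))]
  · refine Finset.sum_congr rfl fun k _ => ?_
    rw [Finset.sum_congr rfl (g := fun _ => (-1 : ℝ) ^ k * (k.choose i : ℝ))
      fun τ hτ => by rw [(Finset.mem_filter.mp hτ).2], Finset.sum_const, nsmul_eq_mul,
      h.interiorCount_eq hS hσ, Finset.filter_filter, mul_comm]
  · intro τ hτ
    obtain ⟨h1, h2⟩ := Finset.mem_filter.mp hτ
    have := h.card_le τ h1
    rw [h2] at this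
    exact Finset.mem_range.mpr (by omega)

theorem simplexCount_self_pos (h : IsCarrierMap F S T carr) {σ : Finset V} (hσ : σ ∈ S) :
    0 < simplexCount F σ.card σ.card := by
  classical
  rw [← h.count σ hσ]
  obtain ⟨τ, hτ, h1, h2⟩ := h.exists_card σ hσ
  exact Finset.card_pos.mpr ⟨τ, Finset.mem_filter.mpr ⟨hτ, h1, h2⟩⟩

end IsCarrierMap

/-! ### Dimension and face numbers -/

section Rank

variable {V : Type*} [Fintype V] (Δ : PreAbstractSimplicialComplex V)

theorem card_le_rank {σ : Finset V} (hσ : σ ∈ allFaces Δ) : σ.card ≤ rank Δ :=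
  le_csSup (Set.toFinite _).bddAbove ⟨σ, hσ, rfl⟩

theorem exists_card_eq_rank : ∃ σ ∈ allFaces Δ, σ.card = rank Δ :=
  Nat.sSup_mem (s := Finset.card '' allFaces Δ) ⟨_, ∅, empty_mem_allFaces Δ, rfl⟩
    (Set.toFinite _).bddAbove

theorem fNumber_eq_card (i : ℕ) :
    fNumber Δ i = ((faceFinset Δ).filter fun σ => σ.card = i).card := by
  rw [fNumber, ← Set.ncard_coe_finset]
  congr 1
  ext σ
  simp [mem_faceFinset]

theorem exists_card_eq_of_le_rank {j : ℕ} (hj : j ≤ rank Δ) :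
    ∃ σ ∈ faceFinset Δ, σ.card = j := by
  obtain ⟨σ, hσ, e⟩ := exists_card_eq_rank Δ
  obtain ⟨τ, hτ, e'⟩ := Finset.exists_subset_card_eq (e ▸ hj)
  exact ⟨τ, mem_faceFinset.mpr (mem_allFaces_of_subset hσ hτ), e'⟩

theorem fNumber_zero : fNumber Δ 0 = 1 := by
  rw [fNumber_eq_card, Finset.card_eq_one]
  refine ⟨∅, Finset.eq_singleton_iff_unique_mem.mpr ⟨?_, ?_⟩⟩
  · simp [mem_faceFinset, empty_mem_allFaces]
  · intro σ hσ
    exact Finset.card_eq_zero.mp (Finset.mem_filter.mp hσ).2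

theorem mem_faceFinset_of_subset {σ : Finset V} (hσ : σ ∈ faceFinset Δ) {τ : Finset V}
    (h : τ ⊆ σ) : τ ∈ faceFinset Δ :=
  mem_faceFinset.mpr (mem_allFaces_of_subset (mem_faceFinset.mp hσ) h)

theorem IsCarrierMap.rank_eq {W : Type*} [Fintype W] {Δ' : PreAbstractSimplicialComplex W}
    {F : ℕ → ℕ → ℕ} {carr : Finset W → Finset V} {Δ : PreAbstractSimplicialComplex V}
    (h : IsCarrierMap F (faceFinset Δ) (faceFinset Δ') carr) : rank Δ' = rank Δ := by
  apply le_antisymm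
  · obtain ⟨τ, hτ, e⟩ := exists_card_eq_rank Δ'
    rw [← e]
    have hτ' := mem_faceFinset.mpr hτ
    exact (h.card_le τ hτ').trans (card_le_rank Δ (mem_faceFinset.mp (h.mem τ hτ')))
  · obtain ⟨σ, hσ, e⟩ := exists_card_eq_rank Δ
    obtain ⟨τ, hτ, -, e'⟩ := h.exists_card σ (mem_faceFinset.mpr hσ)
    rw [← e, ← e']
    exact card_le_rank Δ' (mem_faceFinset.mp hτ)

end Rank

/-! ### Vectors as binary forms -/

/-- The binary form `∑ v_k a^(d-k) b^k`. -/
def binaryForm {d : ℕ} (v : Fin (d + 1) → ℝ) (a b : ℝ) : ℝ :=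
  ∑ k : Fin (d + 1), v k * (a ^ (d - (k : ℕ)) * b ^ (k : ℕ))

theorem coeff_sum_C_mul_X_pow_sub {d : ℕ} (v : Fin (d + 1) → ℝ) (i : Fin (d + 1)) :
    (∑ k : Fin (d + 1), C (v k) * X ^ (d - (k : ℕ)) : ℝ[X]).coeff (d - (i : ℕ)) = v i := by
  rw [finsetSum_coeff, Finset.sum_eq_single i]
  · simp
  · intro k _ hk
    rw [coeff_C_mul_X_pow, if_neg]
    intro e
    apply hk
    have := k.2
    have := i.2
    ext
    omega
  · simp

theorem eval_sum_C_mul_X_pow_sub {d : ℕ} (v : Fin (d + 1) → ℝ) (a : ℝ) :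
    (∑ k : Fin (d + 1), C (v k) * X ^ (d - (k : ℕ)) : ℝ[X]).eval a = binaryForm v a 1 := by
  simp [binaryForm, eval_finsetSum]

/-- This reduces matrix identities to substitutions: `hToF`, `fToH`, `reversal` and reversing the
vector replace `(a, b)` by `(a + b, b)`, `(a - b, b)`, `(-a, a + b)` and `(b, a)`. -/
theorem binaryForm_injective {d : ℕ} {v w : Fin (d + 1) → ℝ}
    (h : ∀ a b, binaryForm v a b = binaryForm w a b) : v = w := by
  have : (∑ k : Fin (d + 1), C (v k) * X ^ (d - (k : ℕ)) : ℝ[X]) =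
      ∑ k : Fin (d + 1), C (w k) * X ^ (d - (k : ℕ)) := by
    refine Polynomial.funext fun a => ?_
    rw [eval_sum_C_mul_X_pow_sub, eval_sum_C_mul_X_pow_sub, h]
  ext i
  rw [← coeff_sum_C_mul_X_pow_sub v, this, coeff_sum_C_mul_X_pow_sub]

theorem binaryForm_one_zero {d : ℕ} (v : Fin (d + 1) → ℝ) : binaryForm v 1 0 = v 0 := by
  rw [binaryForm, Finset.sum_eq_single 0]
  · simp
  · intro k _ hk
    have : (k : ℕ) ≠ 0 := fun e => hk (Fin.ext e)
    simp [this]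
  · simp

theorem binaryForm_rev {d : ℕ} (v : Fin (d + 1) → ℝ) (a b : ℝ) :
    binaryForm (fun i => v i.rev) a b = binaryForm v b a := by
  rw [binaryForm, binaryForm, ← Equiv.sum_comp Fin.revPerm]
  refine Finset.sum_congr rfl fun k _ => ?_
  have hk := k.2
  have h1 : d - (k.rev : ℕ) = k := by rw [Fin.val_rev]; omega
  have h2 : (k.rev : ℕ) = d - k := by rw [Fin.val_rev]; omega
  rw [Fin.revPerm_apply, Fin.rev_rev, h1, h2, mul_comm (a ^ _)]

theorem binaryForm_mulVec {d : ℕ} (M : Matrix (Fin (d + 1)) (Fin (d + 1)) ℝ)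
    (v : Fin (d + 1) → ℝ) (a b : ℝ) :
    binaryForm (M.mulVec v) a b = ∑ j, v j * binaryForm (fun i => M i j) a b := by
  simp only [binaryForm, Matrix.mulVec, dotProduct, Finset.sum_mul, Finset.mul_sum]
  rw [Finset.sum_comm]
  exact Finset.sum_congr rfl fun j _ => Finset.sum_congr rfl fun i _ => by ring

theorem binaryForm_choose {d m : ℕ} (hm : m ≤ d) (a b : ℝ) :
    binaryForm (fun k : Fin (d + 1) => (m.choose k : ℝ)) a b = a ^ (d - m) * (a + b) ^ m := by
  rw [binaryForm, ← Finset.sum_range fun k => (m.choose k : ℝ) * (a ^ (d - k) * b ^ k),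
    add_comm a b, add_pow, Finset.mul_sum]
  symm
  refine Finset.sum_subset_zero_on_sdiff (Finset.range_subset_range.mpr (by omega)) ?_ ?_
  · intro k hk
    rw [Finset.mem_sdiff, Finset.mem_range, Finset.mem_range] at hk
    rw [Nat.choose_eq_zero_of_lt (by omega)]
    simp
  · intro k hk
    rw [Finset.mem_range] at hk
    have : d - k = (d - m) + (m - k) := by omega
    rw [this, pow_add]
    ring

theorem binaryForm_choose_sub {d m : ℕ} (hm : m ≤ d) (a b : ℝ) :
    binaryForm (fun k : Fin (d + 1) => (m.choose (d - (k : ℕ)) : ℝ)) a b =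
      b ^ (d - m) * (a + b) ^ m := by
  rw [← add_comm b a, ← binaryForm_choose hm b a, ← binaryForm_rev]
  congr 1
  ext k
  rw [Fin.val_rev]
  congr 2
  omega

theorem binaryForm_hToF (d : ℕ) (v : Fin (d + 1) → ℝ) (a b : ℝ) :
    binaryForm ((hToF d).mulVec v) a b = binaryForm v (a + b) b := by
  rw [binaryForm_mulVec, binaryForm]
  refine Finset.sum_congr rfl fun j _ => ?_
  have := j.2
  simp only [hToF, Matrix.of_apply]
  rw [binaryForm_choose_sub (Nat.sub_le _ _), Nat.sub_sub_self (by omega),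
    mul_comm (b ^ _)]

theorem binaryForm_fToH (d : ℕ) (v : Fin (d + 1) → ℝ) (a b : ℝ) :
    binaryForm ((fToH d).mulVec v) a b = binaryForm v (a - b) b := by
  rw [binaryForm_mulVec, binaryForm]
  refine Finset.sum_congr rfl fun j _ => ?_
  have hj := j.2
  have : binaryForm (fun i => fToH d i j) a b = (-1) ^ (d - (j : ℕ)) *
      binaryForm (fun k : Fin (d + 1) => ((d - (j : ℕ)).choose (d - (k : ℕ)) : ℝ)) (-a) b := by
    rw [binaryForm, binaryForm, Finset.mul_sum]
    refine Finset.sum_congr rfl fun i _ => ?_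
    have hi := i.2
    have hs : (-1 : ℝ) ^ ((i : ℕ) + (j : ℕ)) = (-1) ^ (d - (j : ℕ)) * (-1) ^ (d - (i : ℕ)) := by
      rw [← pow_add]
      rcases Nat.even_or_odd ((i : ℕ) + j) with he | ho
      · rw [he.neg_one_pow, Even.neg_one_pow]
        grind
      · rw [ho.neg_one_pow, Odd.neg_one_pow]
        grind
    rw [fToH, Matrix.of_apply, hs, neg_pow a]
    ring
  rw [this, binaryForm_choose_sub (Nat.sub_le _ _), Nat.sub_sub_self (by omega),
    mul_left_comm ((-1) ^ _), ← mul_pow, mul_comm (b ^ _)]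
  congr 3
  ring

theorem hToF_mulVec_fToH (d : ℕ) (v : Fin (d + 1) → ℝ) :
    (hToF d).mulVec ((fToH d).mulVec v) = v :=
  binaryForm_injective fun a b => by rw [binaryForm_hToF, binaryForm_fToH, add_sub_cancel_right]

theorem fToH_mulVec_hToF (d : ℕ) (v : Fin (d + 1) → ℝ) :
    (fToH d).mulVec ((hToF d).mulVec v) = v :=
  binaryForm_injective fun a b => by rw [binaryForm_fToH, binaryForm_hToF, sub_add_cancel]

/-- The reversal of `h`-vectors in terms of `f`-vectors. -/
noncomputable def reversal (d : ℕ) : Matrix (Fin (d + 1)) (Fin (d + 1)) ℝ :=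
  Matrix.of fun i j => (-1) ^ (d - (j : ℕ)) * ((j : ℕ).choose i : ℝ)

theorem binaryForm_reversal (d : ℕ) (v : Fin (d + 1) → ℝ) (a b : ℝ) :
    binaryForm ((reversal d).mulVec v) a b = binaryForm v (-a) (a + b) := by
  rw [binaryForm_mulVec, binaryForm]
  refine Finset.sum_congr rfl fun j _ => ?_
  have hj := j.2
  have : binaryForm (fun i => reversal d i j) a b = (-1) ^ (d - (j : ℕ)) *
      binaryForm (fun k : Fin (d + 1) => ((j : ℕ).choose k : ℝ)) a b := by
    rw [binaryForm, binaryForm, Finset.mul_sum]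
    exact Finset.sum_congr rfl fun i _ => by rw [reversal, Matrix.of_apply, mul_assoc]
  rw [this, binaryForm_choose (by omega), neg_pow a]
  ring

theorem hToF_mulVec_rev (d : ℕ) (v : Fin (d + 1) → ℝ) :
    (hToF d).mulVec (fun i => v i.rev) = (reversal d).mulVec ((hToF d).mulVec v) :=
  binaryForm_injective fun a b => by
    rw [binaryForm_hToF, binaryForm_rev, binaryForm_reversal, binaryForm_hToF, neg_add_cancel_left]

theorem fToH_mulVec_reversal (d : ℕ) (v : Fin (d + 1) → ℝ) :
    (fToH d).mulVec ((reversal d).mulVec v) = fun i => (fToH d).mulVec v i.rev :=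
  binaryForm_injective fun a b => by
    rw [binaryForm_fToH, binaryForm_reversal, binaryForm_rev, binaryForm_fToH, sub_add_cancel,
      neg_sub]

theorem hToF_mulVec_zero (d : ℕ) (v : Fin (d + 1) → ℝ) : (hToF d).mulVec v 0 = v 0 := by
  simpa [binaryForm_one_zero] using binaryForm_hToF d v 1 0

theorem fToH_mulVec_zero (d : ℕ) (v : Fin (d + 1) → ℝ) : (fToH d).mulVec v 0 = v 0 := by
  simpa [binaryForm_one_zero] using binaryForm_fToH d v 1 0

/-! ### Symmetry, first row and invertibility of the h-vector transformation -/

theorem hMatrix_mulVec (d : ℕ) (F : ℕ → ℕ → ℕ) (v : Fin (d + 1) → ℝ) :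
    (hMatrix d F).mulVec v = (fToH d).mulVec ((fMatrix d F).mulVec ((hToF d).mulVec v)) := by
  rw [hMatrix, Matrix.mulVec_mulVec, Matrix.mulVec_mulVec, Matrix.mul_assoc]

/-- The symmetry of the transformation of `h`-vectors. -/
theorem hMatrix_mulVec_rev {d : ℕ} {F : ℕ → ℕ → ℕ}
    (h : fMatrix d F * reversal d = reversal d * fMatrix d F) (v : Fin (d + 1) → ℝ) :
    (hMatrix d F).mulVec (fun i => v i.rev) = fun i => (hMatrix d F).mulVec v i.rev := by
  have hcomm : ∀ u, (fMatrix d F).mulVec ((reversal d).mulVec u) =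
      (reversal d).mulVec ((fMatrix d F).mulVec u) := fun u => by
    rw [Matrix.mulVec_mulVec, h, Matrix.mulVec_mulVec]
  rw [hMatrix_mulVec, hToF_mulVec_rev, hcomm, fToH_mulVec_reversal, hMatrix_mulVec]

theorem interiorCount_zero (F : ℕ → ℕ → ℕ) (j : ℕ) :
    interiorCount F 0 j = if j = 0 then 1 else 0 := by
  have h := add_pow (1 : ℝ) (-1) j
  rw [add_neg_cancel, zero_pow_eq] at h
  rw [h, interiorCount]
  refine Finset.sum_congr rfl fun k _ => ?_
  simp [simplexCount, mul_comm]

theorem hMatrix_mulVec_zero (d : ℕ) (F : ℕ → ℕ → ℕ) (v : Fin (d + 1) → ℝ) :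
    (hMatrix d F).mulVec v 0 = v 0 := by
  have h : ∀ w : Fin (d + 1) → ℝ, (fMatrix d F).mulVec w 0 = w 0 := by
    intro w
    rw [Matrix.mulVec, dotProduct, Finset.sum_eq_single 0]
    · simp [fMatrix, interiorCount_zero]
    · intro j _ hj
      have : (j : ℕ) ≠ 0 := fun e => hj (Fin.ext e)
      simp [fMatrix, interiorCount_zero, this]
    · simp
  rw [hMatrix_mulVec, fToH_mulVec_zero, h, hToF_mulVec_zero]

theorem interiorCount_eq_zero_of_lt (F : ℕ → ℕ → ℕ) {i j : ℕ} (h : j < i) :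
    interiorCount F i j = 0 := by
  refine Finset.sum_eq_zero fun k hk => ?_
  rw [Finset.mem_range] at hk
  rw [simplexCount, if_neg (by omega), if_neg (by omega)]
  simp

theorem interiorCount_self (F : ℕ → ℕ → ℕ) (j : ℕ) :
    interiorCount F j j = simplexCount F j j := by
  rw [interiorCount, Finset.sum_range_succ, Finset.sum_eq_zero]
  · simp
  · intro k hk
    rw [Finset.mem_range] at hk
    rw [simplexCount, if_neg (by omega), if_neg (by omega)]
    simp

/-- In f-vector coordinates the matrix is upper triangular, with the numbers of top-dimensional
faces on the diagonal. -/
theorem hMatrix_mulVec_surjective {d : ℕ} {F : ℕ → ℕ → ℕ}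
    (h : ∀ j ≤ d, 0 < simplexCount F j j) (v : Fin (d + 1) → ℝ) :
    ∃ w, (hMatrix d F).mulVec w = v := by
  have hdet : IsUnit (fMatrix d F).det := by
    rw [Matrix.det_of_isUpperTriangular, isUnit_iff_ne_zero, Finset.prod_ne_zero_iff]
    · intro j _
      have hj := h j (Nat.le_of_lt_succ j.2)
      rw [fMatrix, Matrix.of_apply, interiorCount_self]
      exact_mod_cast hj.ne'
    · intro i j hij
      exact interiorCount_eq_zero_of_lt F hij
  refine ⟨(fToH d).mulVec ((fMatrix d F)⁻¹.mulVec ((hToF d).mulVec v)), ?_⟩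
  rw [hMatrix_mulVec, hToF_mulVec_fToH, Matrix.mulVec_mulVec _ (fMatrix d F),
    Matrix.mul_nonsing_inv _ hdet, Matrix.one_mulVec, fToH_mulVec_hToF]

/-! ### `f`-vectors and `h`-vectors of complexes -/

theorem hNumber_eq_mulVec {V : Type*} (Δ : PreAbstractSimplicialComplex V)
    (i : Fin (rank Δ + 1)) :
    hNumber Δ i = (fToH (rank Δ)).mulVec (fun j => (fNumber Δ j : ℝ)) i := by
  rw [hNumber, ← coeff_sum_C_mul_X_pow_sub ((fToH (rank Δ)).mulVec fun j => (fNumber Δ j : ℝ)) i]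
  congr 1
  refine Polynomial.funext fun a => ?_
  rw [eval_sum_C_mul_X_pow_sub, binaryForm_fToH, hPolynomial, fPolynomial,
    Finset.sum_range fun i => C (fNumber Δ i : ℝ) * X ^ (rank Δ - i), eval_comp,
    eval_sum_C_mul_X_pow_sub fun i : Fin (rank Δ + 1) => (fNumber Δ i : ℝ)]
  simp

theorem hNumber_zero {V : Type*} [Fintype V] (Δ : PreAbstractSimplicialComplex V) :
    hNumber Δ 0 = 1 := by
  have := hNumber_eq_mulVec Δ 0
  rw [Fin.val_zero] at this
  rw [this, fToH_mulVec_zero, Fin.val_zero, fNumber_zero, Nat.cast_one]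

namespace IsCarrierMap

variable {V W : Type*} [Fintype V] [Fintype W] {Δ : PreAbstractSimplicialComplex V}
  {Δ' : PreAbstractSimplicialComplex W} {F : ℕ → ℕ → ℕ} {carr : Finset W → Finset V}

/-- Both products have entries `(-1)^(d-j)` times `simplexCount F i j`: the left by sorting the
faces in a simplex by carrier, the right by reciprocity. A face with `j` vertices exists for each `j
≤ rank Δ`, so the geometry controls every column. -/
theorem fMatrix_mul_reversal (h : IsCarrierMap F (faceFinset Δ) (faceFinset Δ') carr) :
    fMatrix (rank Δ) F * reversal (rank Δ) = reversal (rank Δ) * fMatrix (rank Δ) F := by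
  ext i j
  have hj : (j : ℕ) ≤ rank Δ := Nat.le_of_lt_succ j.2
  obtain ⟨σ, hσ, e⟩ := exists_card_eq_of_le_rank Δ hj
  have hsign : ∀ k ≤ rank Δ, (-1 : ℝ) ^ (rank Δ - k) = (-1) ^ rank Δ * (-1) ^ k := by
    intro k hk
    rw [← pow_add]
    rcases Nat.even_or_odd (rank Δ - k) with he | ho
    · rw [he.neg_one_pow, Even.neg_one_pow]
      grind
    · rw [ho.neg_one_pow, Odd.neg_one_pow]
      grind
  have key := h.sum_choose_mul_interiorCount (fun σ hσ τ => mem_faceFinset_of_subset Δ hσ) hσ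
    (e ▸ hj) i
  rw [e, Finset.sum_range] at key
  have hB : ∑ k ∈ Finset.range (rank Δ + 1), interiorCount F i k * ((j : ℕ).choose k : ℝ) =
      simplexCount F i j := by
    classical
    have h1 : (simplexCount F i j : ℝ) = ∑ ρ ∈ σ.powerset, interiorCount F i ρ.card := by
      rw [← e, ← h.count σ hσ i, Finset.card_eq_sum_card_fiberwise (f := carr) (t := σ.powerset)
        (fun τ hτ => Finset.mem_powerset.mpr (Finset.mem_filter.mp hτ).2.1), Nat.cast_sum]
      refine Finset.sum_congr rfl fun ρ hρ => ?_
      have hρσ := Finset.mem_powerset.mp hρ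
      rw [h.interiorCount_eq (fun σ hσ τ => mem_faceFinset_of_subset Δ hσ)
        (mem_faceFinset_of_subset Δ hσ hρσ), Finset.filter_filter]
      congr 2
      refine Finset.filter_congr fun τ _ => ?_
      constructor
      · rintro ⟨⟨-, b⟩, c⟩; exact ⟨c, b⟩
      · rintro ⟨a, b⟩; exact ⟨⟨a ▸ hρσ, b⟩, a⟩
    rw [h1, Finset.sum_powerset_apply_card (fun k => interiorCount F i k), e]
    symm
    refine Finset.sum_subset_zero_on_sdiff (Finset.range_subset_range.mpr (by omega)) ?_ ?_
    · intro k hk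
      rw [Finset.mem_sdiff, Finset.mem_range, Finset.mem_range] at hk
      rw [Nat.choose_eq_zero_of_lt (by omega)]
      simp
    · intro k _
      rw [nsmul_eq_mul, mul_comm]
  rw [Finset.sum_range] at hB
  calc (fMatrix (rank Δ) F * reversal (rank Δ)) i j
      = (-1) ^ (rank Δ - (j : ℕ)) * simplexCount F i j := by
        rw [Matrix.mul_apply, ← hB, Finset.mul_sum]
        refine Finset.sum_congr rfl fun k _ => ?_
        simp only [fMatrix, reversal, Matrix.of_apply]
        ring
    _ = (reversal (rank Δ) * fMatrix (rank Δ) F) i j := by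
        rw [hsign j hj, mul_assoc, ← key, Matrix.mul_apply, Finset.mul_sum]
        refine Finset.sum_congr rfl fun k _ => ?_
        simp only [fMatrix, reversal, Matrix.of_apply]
        rw [hsign k (Nat.le_of_lt_succ k.2)]
        ring

theorem hNumber_eq (h : IsCarrierMap F (faceFinset Δ) (faceFinset Δ') carr)
    (i : Fin (rank Δ + 1)) :
    hNumber Δ' i = (hMatrix (rank Δ) F).mulVec (fun j => hNumber Δ j) i := by
  have h1 : (fun j : Fin (rank Δ + 1) => (fNumber Δ' j : ℝ)) =
      (fMatrix (rank Δ) F).mulVec fun j => (fNumber Δ j : ℝ) := by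
    ext j
    rw [fNumber_eq_card, h.card_filter_eq (fun σ hσ τ => mem_faceFinset_of_subset Δ hσ)
      (fun σ hσ => card_le_rank Δ (mem_faceFinset.mp hσ)), Finset.sum_range]
    simp only [Matrix.mulVec, dotProduct, fMatrix, Matrix.of_apply, fNumber_eq_card]
  have h2 : ∀ i : Fin (rank Δ + 1), hNumber Δ' i =
      (fToH (rank Δ)).mulVec (fun j => (fNumber Δ' j : ℝ)) i := by
    rw [← h.rank_eq]
    exact hNumber_eq_mulVec Δ'
  have h3 : (fun j : Fin (rank Δ + 1) => hNumber Δ j) =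
      (fToH (rank Δ)).mulVec fun j => (fNumber Δ j : ℝ) := funext fun j => hNumber_eq_mulVec Δ j
  rw [h2, h1, h3, hMatrix_mulVec, hToF_mulVec_fToH]

end IsCarrierMap

/-! ### Total positivity -/

theorem IsTP.entry_nonneg {r m n : ℕ} (hr : 1 ≤ r) {A : Matrix (Fin m) (Fin n) ℝ} (h : IsTP r A)
    (i : Fin m) (j : Fin n) : 0 ≤ A i j := by
  have := h 1 le_rfl hr (fun _ => i) (fun _ => j) (Subsingleton.strictMono _)
    (Subsingleton.strictMono _)
  simpa using this

theorem IsTP.minor_nonneg {m n : ℕ} {A : Matrix (Fin m) (Fin n) ℝ} (h : IsTP 2 A)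
    {i i' : Fin m} (hi : i < i') {j j' : Fin n} (hj : j < j') :
    0 ≤ A i j * A i' j' - A i j' * A i' j := by
  have := h 2 (by norm_num) le_rfl ![i, i'] ![j, j']
    (by simpa [Fin.strictMono_iff_lt_succ] using hi)
    (by simpa [Fin.strictMono_iff_lt_succ] using hj)
  rw [Matrix.det_fin_two] at this
  simpa using this

/-- The `2 × 2` case of the Cauchy–Binet formula, as an inequality. -/
theorem dotProduct_mul_dotProduct_le {n : ℕ} {p q u w : Fin n → ℝ}
    (hpq : ∀ k l, k < l → 0 ≤ p k * q l - p l * q k)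
    (huw : ∀ k l, k < l → u l * w k ≤ u k * w l) :
    dotProduct q u * dotProduct p w ≤ dotProduct p u * dotProduct q w := by
  have h1 : ∀ a b c e : Fin n → ℝ, dotProduct a b * dotProduct c e =
      ∑ k, ∑ l, (a k * b k) * (c l * e l) := fun a b c e => by
    rw [dotProduct, dotProduct, Finset.sum_mul_sum]
  -- Summing over ordered pairs `(k, l)` counts each product of minors twice, hence the factor 2;
  -- exchanging `k` and `l` changes both signs.
  have h2 : 2 * (dotProduct p u * dotProduct q w - dotProduct q u * dotProduct p w) =
      ∑ k, ∑ l, (p k * q l - p l * q k) * (u k * w l - u l * w k) := by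
    have e1 : dotProduct p u * dotProduct q w = ∑ k, ∑ l, (p l * u l) * (q k * w k) := by
      rw [h1, Finset.sum_comm]
    have e2 : dotProduct q u * dotProduct p w = ∑ k, ∑ l, (q l * u l) * (p k * w k) := by
      rw [h1, Finset.sum_comm]
    rw [two_mul]
    nth_rw 1 [h1 p u q w, h1 q u p w]
    rw [e1, e2]
    simp only [← Finset.sum_sub_distrib, ← Finset.sum_add_distrib]
    exact Finset.sum_congr rfl fun k _ => Finset.sum_congr rfl fun l _ => by ring
  have h3 : 0 ≤ ∑ k, ∑ l, (p k * q l - p l * q k) * (u k * w l - u l * w k) := by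
    refine Finset.sum_nonneg fun k _ => Finset.sum_nonneg fun l _ => ?_
    rcases lt_trichotomy k l with hkl | rfl | hkl
    · exact mul_nonneg (hpq k l hkl) (sub_nonneg.mpr (huw k l hkl))
    · simp
    · exact mul_nonneg_of_nonpos_of_nonpos (by linarith [hpq l k hkl]) (by linarith [huw l k hkl])
  linarith

theorem IsTP.mulVec_mul_mulVec_le {m n : ℕ} {A : Matrix (Fin m) (Fin n) ℝ} (h : IsTP 2 A)
    {i i' : Fin m} (hi : i < i') {u w : Fin n → ℝ}
    (huw : ∀ k l, k < l → u l * w k ≤ u k * w l) :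
    A.mulVec u i' * A.mulVec w i ≤ A.mulVec u i * A.mulVec w i' :=
  dotProduct_mul_dotProduct_le (fun _ _ hkl => h.minor_nonneg hi hkl) huw

theorem le_of_forall_lt_le_succ {f : ℕ → ℝ} {a b : ℕ} (h : ∀ i, a ≤ i → i < b → f i ≤ f (i + 1))
    {k l : ℕ} (hk : a ≤ k) (hkl : k ≤ l) (hl : l ≤ b) : f k ≤ f l := by
  induction l, hkl using Nat.le_induction with
  | base => exact le_rfl
  | succ l hkl ih => exact (ih (by omega)).trans (h l (by omega) (by omega))

/-! ### Transport of the ratio conditions by a TP₂ matrix -/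

section Vectors

variable {d : ℕ} {H : Matrix (Fin (d + 1)) (Fin (d + 1)) ℝ} {h h' : ℕ → ℝ}

theorem mulVec_pos (hTP : IsTP 2 H) (hh : ∀ i, i ≤ d → 0 ≤ h i) {i j : Fin (d + 1)}
    (hH : H i j ≠ 0) (hj : 0 < h j) : 0 < H.mulVec (fun j => h j) i := by
  have h0 := hTP.entry_nonneg one_le_two i
  refine Finset.sum_pos' (fun k _ => mul_nonneg (h0 k) (hh k (Nat.le_of_lt_succ k.2)))
    ⟨j, Finset.mem_univ _, mul_pos (lt_of_le_of_ne (h0 j) hH.symm) hj⟩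

theorem increasing_of_mulVec (hTP : IsTP 2 H)
    (hsurj : ∀ v, ∃ w, H.mulVec w = v)
    (hh' : ∀ i : Fin (d + 1), h' i = H.mulVec (fun j => h j) i)
    (hrev : ∀ i : Fin (d + 1), h' (d - i) = H.mulVec (fun j => h (d - j)) i)
    (hpos : ∀ i, i ≤ d → 0 < h i)
    (hratio : ∀ i, i < d → h i / h (d - i) ≤ h (i + 1) / h (d - (i + 1))) :
    (∀ i, i ≤ d → 0 < h' i) ∧
      ∀ i, i < d → h' i / h' (d - i) ≤ h' (i + 1) / h' (d - (i + 1)) := by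
  have hpos' : ∀ i, i ≤ d → 0 < h' i := by
    intro i hi
    -- Surjectivity serves only to show that row `i` has a non-zero entry.
    obtain ⟨w, hw⟩ := hsurj (Pi.single ⟨i, Nat.lt_succ_of_le hi⟩ 1)
    have hne : H.mulVec w ⟨i, Nat.lt_succ_of_le hi⟩ ≠ 0 := by rw [hw]; simp
    rw [Matrix.mulVec, dotProduct] at hne
    obtain ⟨j, -, hj⟩ := Finset.exists_ne_zero_of_sum_ne_zero hne
    rw [hh' ⟨i, Nat.lt_succ_of_le hi⟩]
    exact mulVec_pos hTP (fun i hi => (hpos i hi).le) (left_ne_zero_of_mul hj)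
      (hpos j (Nat.le_of_lt_succ j.2))
  refine ⟨hpos', fun i hi => ?_⟩
  rw [div_le_div_iff₀ (hpos' _ (by omega)) (hpos' _ (by omega))]
  have := hTP.mulVec_mul_mulVec_le (i := ⟨i, by omega⟩) (i' := ⟨i + 1, by omega⟩)
    (Fin.mk_lt_mk.mpr (Nat.lt_succ_self i)) (u := fun j => h (d - j)) (w := fun j => h j) ?_
  · rw [← hh', ← hh', ← hrev, ← hrev] at this
    linarith
  · intro k l hkl
    have hk := k.2
    have hl := l.2
    have := le_of_forall_lt_le_succ (f := fun i => h i / h (d - i)) (a := 0) (b := d)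
      (fun i _ hi => hratio i hi) (Nat.zero_le k) (Fin.lt_def.mp hkl).le (by omega)
    rw [div_le_div_iff₀ (hpos _ (by omega)) (hpos _ (by omega))] at this
    linarith

/-- Compared with the increasing case the vector and its reversal exchange roles. The ratios control
only the indices `1, …, d - 1`; a minor using column `0` or `d` has the right sign because its
subtracted product contains `h d = 0`. -/
theorem decreasing_of_mulVec (hTP : IsTP 2 H)
    (hsurj : ∀ v, ∃ w, H.mulVec w = v)
    (hlast : ∀ v, H.mulVec v (Fin.last d) = v (Fin.last d))
    (hh' : ∀ i : Fin (d + 1), h' i = H.mulVec (fun j => h j) i)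
    (hrev : ∀ i : Fin (d + 1), h' (d - i) = H.mulVec (fun j => h (d - j)) i)
    (hzero : 0 < h 0)
    (hpos : ∀ i, 1 ≤ i → i < d → 0 < h i) (hd : h d = 0)
    (hratio : ∀ i, 1 ≤ i → i + 1 < d → h i / h (d - i) ≥ h (i + 1) / h (d - (i + 1))) :
    (∀ i, 1 ≤ i → i < d → 0 < h' i) ∧ h' d = 0 ∧
      ∀ i, 1 ≤ i → i + 1 < d → h' i / h' (d - i) ≥ h' (i + 1) / h' (d - (i + 1)) := by
  have hpos0 : ∀ i, i < d → 0 < h i := by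
    intro i hi
    rcases Nat.eq_zero_or_pos i with rfl | h1
    · exact hzero
    · exact hpos i h1 hi
  have hnonneg : ∀ i, i ≤ d → 0 ≤ h i := by
    intro i hi
    rcases hi.eq_or_lt with rfl | hlt
    · exact hd.ge
    · exact (hpos0 i hlt).le
  have hpos' : ∀ i, 1 ≤ i → i < d → 0 < h' i := by
    intro i h1 hi
    obtain ⟨w, hw⟩ := hsurj (Pi.single ⟨i, by omega⟩ 1)
    have hne : H.mulVec w ⟨i, by omega⟩ ≠ 0 := by rw [hw]; simp
    -- Since `i < d` and the last row of `H` is a unit vector, `w` vanishes at `d`; so the non-zero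
    -- entry of row `i` found below lies in a column where `h` is positive.
    have hwd : w (Fin.last d) = 0 := by
      rw [← hlast w, hw, Pi.single_eq_of_ne]
      intro e
      have := congrArg Fin.val e
      simp at this
      omega
    rw [Matrix.mulVec, dotProduct] at hne
    obtain ⟨j, -, hj⟩ := Finset.exists_ne_zero_of_sum_ne_zero hne
    rw [hh' ⟨i, by omega⟩]
    refine mulVec_pos hTP hnonneg (left_ne_zero_of_mul hj) (hpos0 j ?_)
    refine lt_of_le_of_ne (Nat.le_of_lt_succ j.2) fun e => right_ne_zero_of_mul hj ?_
    rw [← hwd]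
    congr 1
    exact Fin.ext e
  refine ⟨hpos', ?_, fun i h1 hi => ?_⟩
  · have := hh' (Fin.last d)
    rw [hlast, Fin.val_last] at this
    rw [this, hd]
  rw [ge_iff_le, div_le_div_iff₀ (hpos' _ (by omega) (by omega)) (hpos' _ (by omega) (by omega))]
  have := hTP.mulVec_mul_mulVec_le (i := ⟨i, by omega⟩) (i' := ⟨i + 1, by omega⟩)
    (Fin.mk_lt_mk.mpr (Nat.lt_succ_self i)) (u := fun j => h j) (w := fun j => h (d - j)) ?_
  · rwa [← hh', ← hh', ← hrev, ← hrev] at this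
  · intro k l hkl
    have hkl' : (k : ℕ) < l := hkl
    have hl := l.2
    rcases Nat.eq_zero_or_pos (k : ℕ) with hk0 | hk0
    · rw [hk0, Nat.sub_zero, hd, mul_zero]
      exact mul_nonneg hzero.le (hnonneg _ (by omega))
    rcases (Nat.le_of_lt_succ hl).eq_or_lt with hld | hld
    · rw [hld, hd, zero_mul]
      exact mul_nonneg (hnonneg _ (by omega)) (hnonneg _ (by omega))
    have := le_of_forall_lt_le_succ (f := fun i => -(h i / h (d - i))) (a := 1) (b := d - 1)
      (fun i h1 hi => neg_le_neg (hratio i h1 (by omega))) hk0 hkl'.le (by omega)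
    rw [neg_le_neg_iff, div_le_div_iff₀ (hpos _ (by omega) (by omega))
      (hpos _ (by omega) (by omega))] at this
    exact this

end Vectors

end FaceUniform

/-! ### The proposition -/

theorem mainTheorem2 (d : ℕ) (F : ℕ → ℕ → ℕ) (hTP : FaceUniform.IsTP 2 (FaceUniform.hMatrix d F))
    {V W E : Type*} [Finite V] [Finite W] [AddCommGroup E] [Module ℝ E]
    (Δ : PreAbstractSimplicialComplex V) (ΔF : PreAbstractSimplicialComplex W)
    (hd : FaceUniform.rank Δ = d)
    (hF : FaceUniform.IsFaceUniformSubdivision E F Δ ΔF) :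
    (FaceUniform.IncreasingRatios Δ → FaceUniform.IncreasingRatios ΔF) ∧
    (FaceUniform.DecreasingRatios Δ → FaceUniform.DecreasingRatios ΔF) := by
  open FaceUniform in
  have := Fintype.ofFinite V
  have := Fintype.ofFinite W
  subst hd
  obtain ⟨carr, hc⟩ := hF.exists_isCarrierMap
  have hrank := hc.rank_eq
  have hsurj := hMatrix_mulVec_surjective (d := rank Δ) (F := F) fun j hj => by
    obtain ⟨σ, hσ, rfl⟩ := exists_card_eq_of_le_rank Δ hj
    exact hc.simplexCount_self_pos hσ
  have hval : ∀ i : Fin (rank Δ + 1), (i.rev : ℕ) = rank Δ - i := fun i => by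
    rw [Fin.val_rev]; omega
  have hsymm := hMatrix_mulVec_rev hc.fMatrix_mul_reversal
  -- The first row is a unit vector because the empty face is counted once; the symmetry carries
  -- this to the last row.
  have hlast : ∀ v, (hMatrix (rank Δ) F).mulVec v (Fin.last _) = v (Fin.last _) := fun v => by
    have := congrFun (hsymm v) 0
    rw [hMatrix_mulVec_zero] at this
    simpa using this.symm
  have hrev : ∀ i : Fin (rank Δ + 1), hNumber ΔF (rank Δ - i) =
      (hMatrix (rank Δ) F).mulVec (fun j => hNumber Δ (rank Δ - j)) i := fun i => by
    have := congrFun (hsymm fun j => hNumber Δ j) i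
    simp only [hval] at this
    rw [this, ← hc.hNumber_eq, hval]
  refine ⟨fun h => ?_, fun h => ?_⟩
  · rw [IncreasingRatios, hrank]
    exact increasing_of_mulVec hTP hsurj hc.hNumber_eq hrev h.1 h.2
  · rw [DecreasingRatios, hrank]
    exact decreasing_of_mulVec hTP hsurj hlast hc.hNumber_eq hrev
      (by rw [hNumber_zero]; exact one_pos) h.1 h.2.1 h.2.2
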